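/- **Theorem 2 (Hole-free).** *Setting.* Cells of the hexagonal tiling are given axial coordinates $(p,q)\in\mathcal H=\mathbb Z^2$ ($p$ = column, $q$ = row). The six walls $w=0,\dots,5$ (F, FL, RL, R, RR, FR, counter-clockwise, indices mod 6) have unit vectors $\hat u_0=(0,1)$, $\hat u_1=(-1,1)$, $\hat u_2=(-1,0)$, $\hat u_3=(0,-1)$, $\hat u_4=(1,-1)$, $\hat u_5=(1,0)$; two cells are adjacent if they differ by some $\hat u_w$. Walls $0,3$ are fore-aft, $\{1,2\}$ is the left flank and $\{4,5\}$ the right flank. A simple cycle of adjacent cells *encloses* a cell $y$ not on it if the centre of $y$ lies in the interior of the closed polygon through the centres of the cycle's cells. Let $S\subset\mathcal H$ be a finite set with $(0,0)\in S$ that is *hole-free*: no simple cycle of cells of $S$ encloses a cell outside $S$. Let $X_b$ be the perimeter of $S$, i.e. the cells of $S$ with at least one neighbour outside $S$. Robots know only $X_b$; they call a cell a *target* cell if it is in $X_b$ or enclosed by a simple cycle contained in $X_b$. A *segment* is a maximal contiguous set of target cells in one column; its midpoint is rounded down. *Wall statuses.* When $X(t)$ is the set of occupied cells, wall $w$ of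 a robot at $x$ has status $s_w$ = null if $x+\hat u_w$ is not a target cell, and otherwise occupied or free according to whether $x+\hat u_w\in X(t)$. *Initialization (once, on docking at $x=(p,q)$).* For each flank, with column direction $a=-1$ (left) or $a=1$ (right), the robot sets a nucleation flag $\alpha$: (i) if the flank has no free wall, $\alpha$ is false; (ii) if some free wall of the flank has two null adjacent walls, $\alpha$ is true; (iii) otherwise let $Q'$ be the segment of column $p+a$ that the flank faces, $q_m$ the row of its midpoint, and $Q$ the segment of $x$: $\alpha$ is true if $q=q_m$; false if $q\neq q_m$ and $(p,q_m)\in Q$; and otherwise $\alpha$ is true iff $q=q^\star$, where $q^\star$ is the row nearest to $q_m$ with $(p+a,q^\star)\in Q'$ and $(p,q^\star)\in Q$. The growth direction is $g=0$ if both flags are true; else $g=1$ if $s_1$ or $s_2$ is occupied or $\alpha_{\rm right}$ is true; else $g=-1$ if $s_4$ or $s_5$ is occupied or $\alpha_{\rm left}$ is true; else $g=0$. The flags and $g$ are then fixed. *Signals (at every time step).* If wall 0 or wall 3 is free, the nominal walls are the free fore-aft walls. Otherwise they are the free flank walls that lie between two occupied walls, or between a null fore-aft wall and an occupied wall, or belong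 to a flank whose flag $\alpha$ is true. Delayed walls: if $g=-1$, wall 0 when wall 5 is occupied by a robot whose wall 0 is free, and wall 3 when wall 4 is occupied by a robot whose wall 3 is free; if $g=1$, the same with walls 1 and 2 in place of 5 and 4. The robot signals on its nominal walls that are not delayed. *Execution.* At $t=0$ only the root robot is present, at $(0,0)$, initialized there. In each step an arbitrary (possibly empty) set of robots dock, each at a cell towards which a robot already in the assembly signals; a docking robot initializes itself with the occupancy it finds, which includes all robots present before the step and possibly some of those docking in the same step. Robots never leave. $G(t)$ is the graph on the occupied cells $X(t)$ in which adjacent occupied cells are joined. *Claim.* In every execution and at every time $t$, $G(t)$ is hole-free: no simple cycle in $G(t)$ encloses a cell of $S\setminus X(t)$. -/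

import Mathlib

namespace Huddle

/-! ### The hexagonal lattice, assembly graphs and enclosed positions -/

/-- Axial coordinates `(p, q)` of hexagonal cells: `p` is the column, `q` the row. -/
abbrev Hex : Type := ℤ × ℤ

/-- The six walls of a robot, counter-clockwise:
`0 = F`, `1 = FL`, `2 = RL`, `3 = R`, `4 = RR`, `5 = FR`. Indices are taken modulo 6. -/
abbrev Wall : Type := Fin 6

/-- The unit vector of a wall. -/
def dir : Wall → Hex := ![(0, 1), (-1, 1), (-1, 0), (0, -1), (1, -1), (1, 0)]

theorem dir_add_three (w : Wall) : dir (w + 3) = -dir w := by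
  fin_cases w <;> rfl

theorem dir_ne_zero (w : Wall) : dir w ≠ 0 := by
  fin_cases w <;> decide

/-- The graph of a set `X` of occupied positions: two occupied positions are joined when they
share a wall. (Positions outside `X` are isolated.) -/
def assemblyGraph (X : Set Hex) : SimpleGraph Hex where
  Adj x y := x ∈ X ∧ y ∈ X ∧ ∃ w, y = x + dir w
  symm := ⟨by
    rintro x y ⟨hx, hy, w, rfl⟩
    exact ⟨hy, hx, w + 3, by rw [dir_add_three]; abel⟩⟩
  loopless := ⟨by
    rintro x ⟨-, -, w, h⟩
    exact dir_ne_zero w (by simpa using h)⟩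

/-- The straight edge from `a` to `b` leads from the column of `y` to the next column on the
right, and starts ahead of `y`. Equivalently, it meets the ray that leaves the centre of `y`
in the forward direction, tilted to the right by an infinitesimal angle. -/
def crossesRay (y a b : Hex) : Prop := a.1 = y.1 ∧ b.1 = y.1 + 1 ∧ y.2 < a.2

instance (y a b : Hex) : Decidable (crossesRay y a b) := by
  unfold crossesRay; infer_instance

/-- The position `y` lies in the interior of the closed polygon traced by `c` (through cell
centres): `y` is not on `c`, and a generic ray from `y` to infinity crosses the edges of `c` an odd
number of times (ray casting, i.e. the even-odd rule). -/
def Encloses {G : SimpleGraph Hex} {v : Hex} (c : G.Walk v v) (y : Hex) : Prop :=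
  y ∉ c.support ∧
    Odd (c.darts.countP fun d => decide (crossesRay y d.fst d.snd ∨ crossesRay y d.snd d.fst))

/-- A shape is hole-free: no simple cycle of cells of `S` encloses a position outside `S`. -/
def HoleFreeShape (S : Set Hex) : Prop :=
  ∀ (v : Hex) (c : (assemblyGraph S).Walk v v), c.IsCycle → ∀ y, Encloses c y → y ∈ S

/-- An assembly that occupies the positions `X` is hole-free with respect to the target
shape `S`: no simple cycle of the assembly graph encloses an unoccupied position of `S`. -/
def HoleFreeAssembly (S X : Set Hex) : Prop :=
  ∀ (v : Hex) (c : (assemblyGraph X).Walk v v), c.IsCycle → ∀ y ∈ S \ X, ¬ Encloses c y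

/-- The perimeter of a shape: its cells with at least one unattached side. -/
def perimeter (S : Set Hex) : Set Hex := {x | x ∈ S ∧ ∃ w, x + dir w ∉ S}

/-! ### The robots

All rules below see the target shape only through its perimeter `Xb`. -/

/-- The positions a robot takes to be target positions: those in `Xb` or enclosed by a simple
cycle contained in `Xb`. -/
def target (Xb : Set Hex) : Set Hex :=
  {y | y ∈ Xb ∨ ∃ (v : Hex) (c : (assemblyGraph Xb).Walk v v), c.IsCycle ∧ Encloses c y}

inductive Status
  | null
  | free
  | occupied
  deriving DecidableEq

inductive Flank
  | left
  | right

/-- The two walls of a flank. -/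
def Flank.walls : Flank → Set Wall
  | .left => {1, 2}
  | .right => {4, 5}

/-- The column direction of a flank. -/
def Flank.column : Flank → ℤ
  | .left => -1
  | .right => 1

/-- The front and the rear wall. -/
def foreAft : Set Wall := {0, 3}

open Classical in
/-- The wall status vector of a robot at `x` when the positions `X` are occupied. A wall is a
connection wall when it faces a target position, and a null wall otherwise. -/
noncomputable def status (Xb X : Set Hex) (x : Hex) (w : Wall) : Status :=
  if x + dir w ∈ target Xb then (if x + dir w ∈ X then .occupied else .free) else .null

open Classical in
/-- Nucleation requirement of a flank from the robot's own wall status vector `s`;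
`none` stands for "undefined". -/
noncomputable def roleFromSelf (s : Wall → Status) (f : Flank) : Option Bool :=
  if ∃ w ∈ f.walls, s w = .free then
    if ∃ w ∈ f.walls, s w = .free ∧ s (w + 1) = .null ∧ s (w - 1) = .null then some true
    else none
  else some false

/-- Rows of the contiguous column segment of target positions that contains `x`
(empty when `x` is not a target position). -/
def segmentRows (Xb : Set Hex) (x : Hex) : Set ℤ :=
  {r | ∀ k ∈ Set.uIcc x.2 r, (x.1, k) ∈ target Xb}

/-- Rows of the target segment in the adjacent column that a flank of a robot at `x` faces.
(The two positions faced by a flank are neighbours in one column, so if both are target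
positions, they lie in the same segment.) -/
def facingRows (Xb : Set Hex) (x : Hex) (f : Flank) : Set ℤ :=
  {r | ∃ w ∈ f.walls, x + dir w ∈ target Xb ∧ r ∈ segmentRows Xb (x + dir w)}

/-- Row of the midpoint, rounded down, of a segment with rows `Q`. -/
noncomputable def midRow (Q : Set ℤ) : ℤ := (sInf Q + sSup Q) / 2

open Classical in
/-- Nucleation requirement of a flank from the target segments of the adjacent column. In the
last case, `q` is required to be the row of the point nearest to the midpoint, among the points of
the adjacent segment that have a neighbour on their own row in the robot's segment. -/
noncomputable def roleFromColumn (Xb : Set Hex) (x : Hex) (f : Flank) : Bool :=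
  if ∀ q, (x.1 + f.column, q) ∉ target Xb then false
  else
    let m := midRow (facingRows Xb x f)
    if x.2 = m then true
    else if m ∈ segmentRows Xb x then false
    else
      let R := facingRows Xb x f ∩ segmentRows Xb x
      decide (x.2 ∈ R ∧ ∀ r ∈ R, |x.2 - m| ≤ |r - m|)

/-- The nucleation requirement of a flank. -/
noncomputable def nucleates (Xb X : Set Hex) (x : Hex) (f : Flank) : Bool :=
  (roleFromSelf (status Xb X x) f).getD (roleFromColumn Xb x f)

/-- The growth direction: `1` right, `-1` left, `0` neutral. -/
def growthDirection (s : Wall → Status) (αl αr : Bool) : ℤ :=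
  if αl = true ∧ αr = true then 0
  else if (s 1 = .occupied ∨ s 2 = .occupied) ∨ αr = true then 1
  else if (s 4 = .occupied ∨ s 5 = .occupied) ∨ αl = true then -1
  else 0

/-- What a robot fixes once and for all when it docks: the nucleation requirements of its flanks
and its growth direction. -/
structure Memory where
  nucLeft : Bool
  nucRight : Bool
  growth : ℤ

/-- The initialization phase of a robot docking at `x` that finds the positions `X` occupied. -/
noncomputable def initMemory (Xb X : Set Hex) (x : Hex) : Memory where
  nucLeft := nucleates Xb X x .left
  nucRight := nucleates Xb X x .right
  growth := growthDirection (status Xb X x) (nucleates Xb X x .left) (nucleates Xb X x .right)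

open Classical in
/-- The walls that nominally require a signal. Fore-aft walls have priority. A free flank wall
signals if it is between two occupied walls, or between a null fore-aft wall and an occupied wall,
or if its flank has to be nucleated. -/
noncomputable def nominalWalls (s : Wall → Status) (m : Memory) : Set Wall :=
  if s 0 = .free ∨ s 3 = .free then {w | w ∈ foreAft ∧ s w = .free}
  else
    {w | w ∉ foreAft ∧ s w = .free ∧
      ((s (w + 1) = .occupied ∧ s (w - 1) = .occupied) ∨
        (w + 1 ∈ foreAft ∧ s (w + 1) = .null ∧ s (w - 1) = .occupied) ∨
        (w - 1 ∈ foreAft ∧ s (w - 1) = .null ∧ s (w + 1) = .occupied))} ∪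
    {w | m.nucLeft = true ∧ w ∈ Flank.left.walls ∧ s w = .free} ∪
    {w | m.nucRight = true ∧ w ∈ Flank.right.walls ∧ s w = .free}

/-- The walls whose signal is delayed; `n w` is the wall status vector of the neighbour at
wall `w` (only used when that wall is occupied). -/
def delayedWalls (s : Wall → Status) (n : Wall → Wall → Status) (g : ℤ) : Set Wall :=
  {w | (g = -1 ∧ ((w = 0 ∧ s 5 = .occupied ∧ n 5 0 = .free) ∨
                  (w = 3 ∧ s 4 = .occupied ∧ n 4 3 = .free))) ∨
       (g = 1 ∧ ((w = 0 ∧ s 1 = .occupied ∧ n 1 0 = .free) ∨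
                 (w = 3 ∧ s 2 = .occupied ∧ n 2 3 = .free)))}

/-- The walls on which a robot at `x` with memory `m` signals when the positions `X` are
occupied. -/
noncomputable def signals (Xb X : Set Hex) (x : Hex) (m : Memory) : Set Wall :=
  nominalWalls (status Xb X x) m \
    delayedWalls (status Xb X x) (fun w => status Xb X (x + dir w)) m.growth

/-! ### Executions -/

/-- A state of the assembly: which positions hold a robot, and the memory of that robot. -/
abbrev State : Type := Hex → Option Memory

/-- The occupied positions. -/
def occupied (σ : State) : Set Hex := {x | ∃ m, σ x = some m}

/-- The initial state: only the root robot, at the origin. -/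
def IsInitial (Xb : Set Hex) (σ : State) : Prop :=
  σ (0, 0) = some (initMemory Xb {(0, 0)} (0, 0)) ∧ ∀ x, x ≠ (0, 0) → σ x = none

/-- One time step. Robots in the assembly stay with their memory unchanged. Any set of passing-by
robots (possibly empty, possibly several at once) dock, each at an opening towards which some robot
of the assembly signals. A docking robot initializes itself with the occupancy `V` that it
finds: every robot of the previous state, and an arbitrary part of those that dock in this step. -/
def Step (Xb : Set Hex) (σ τ : State) : Prop :=
  (∀ x m, σ x = some m → τ x = some m) ∧
  ∀ y m, σ y = none → τ y = some m →
    (∃ x mx w, σ x = some mx ∧ w ∈ signals Xb (occupied σ) x mx ∧ y = x + dir w) ∧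
    ∃ V, occupied σ ⊆ V ∧ V ⊆ occupied τ ∧ m = initMemory Xb V y

/-- A sequence of states produced by robots that follow the rules with perimeter `Xb`. -/
def IsExecution (Xb : Set Hex) (σ : ℕ → State) : Prop :=
  IsInitial Xb (σ 0) ∧ ∀ t, Step Xb (σ t) (σ (t + 1))

end Huddle

/-!
In a hole-free shape the maximal column segments form a tree. Call the neighbour of a segment in the
direction of the root its parent; the cells of a segment that touch its parent all touch the same
parent segment. An execution keeps the occupied part of each segment contiguous: an empty segment is
entered only next to the unique nucleation site in its parent, and afterwards it grows only next to
occupied cells, because the delayed signals make each segment lag behind its parent. A contiguous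
subset of a hole-free shape encloses no cell `y` of the shape: one of the two halves of the segment
of `y` is unoccupied, so a cycle winds around `y` as it does around the first cell outside the shape
at the end of that half.

Crossings with the ray ahead of a cell are counted modulo two, as an edge function with values in
`ZMod 2`. A cell outside the graph is enclosed by no simple cycle exactly when this edge function
has a potential on the graph, and then its sum vanishes along every closed walk, simple or not.
Stokes' theorem for this edge function shows that the perimeter determines the shape.
-/

namespace Huddle

open SimpleGraph

theorem eq_of_reachable_of_forall_adj {V α : Type*} {G : SimpleGraph V} {φ : V → α}
    (hφ : ∀ a b, G.Adj a b → φ a = φ b) {u v : V} (huv : G.Reachable u v) : φ u = φ v := by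
  obtain ⟨p⟩ := huv
  induction p with
  | nil => rfl
  | cons e _ ih => exact (hφ _ _ e).trans ih

section Potential

variable {V A : Type*} [AddCommGroup A] {G H : SimpleGraph V} {h h' : V → V → A}

/-- The sum of an edge function `h` along a walk; the edge from `a` to `b` contributes `h a b`. -/
def walkSum (h : V → V → A) {u v : V} (p : G.Walk u v) : A :=
  (p.darts.map fun d => h d.fst d.snd).sum

@[simp] theorem walkSum_nil (h : V → V → A) (u : V) :
    walkSum h (Walk.nil : G.Walk u u) = 0 := rfl

@[simp] theorem walkSum_cons (h : V → V → A) {u v w : V} (e : G.Adj u v) (p : G.Walk v w) :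
    walkSum h (Walk.cons e p) = h u v + walkSum h p := by
  simp [walkSum]

@[simp] theorem walkSum_append (h : V → V → A) {u v w : V} (p : G.Walk u v) (q : G.Walk v w) :
    walkSum h (p.append q) = walkSum h p + walkSum h q := by
  simp [walkSum]

theorem walkSum_reverse (hanti : ∀ a b, h b a = -h a b) {u v : V} (p : G.Walk u v) :
    walkSum h p.reverse = -walkSum h p := by
  induction p with
  | nil => simp
  | cons e p ih =>
    rw [Walk.reverse_cons, walkSum_append, walkSum_cons, walkSum_cons, ih, walkSum_nil, hanti]
    abel

/-- The edge function `h` is the coboundary of a vertex function (a potential) on the edges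
of `G`. -/
def HasPotential (G : SimpleGraph V) (h : V → V → A) : Prop :=
  ∃ φ : V → A, ∀ a b, G.Adj a b → h a b = φ b - φ a

theorem HasPotential.mono (hh : HasPotential G h) (hle : H ≤ G) : HasPotential H h :=
  hh.imp fun _ hφ a b hab => hφ a b (hle hab)

theorem HasPotential.congr (hh : HasPotential G h) (heq : ∀ a b, G.Adj a b → h' a b = h a b) :
    HasPotential G h' :=
  hh.imp fun _ hφ a b hab => (heq a b hab).trans (hφ a b hab)

theorem HasPotential.add (hh : HasPotential G h) (hh' : HasPotential G h') :
    HasPotential G (h + h') := by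
  obtain ⟨φ, hφ⟩ := hh
  obtain ⟨ψ, hψ⟩ := hh'
  refine ⟨φ + ψ, fun a b hab => ?_⟩
  simp only [Pi.add_apply, hφ a b hab, hψ a b hab]
  abel

theorem walkSum_eq_sub {φ : V → A} (hφ : ∀ a b, G.Adj a b → h a b = φ b - φ a) {u v : V}
    (p : G.Walk u v) : walkSum h p = φ v - φ u := by
  induction p with
  | nil => simp
  | cons e p ih =>
    rw [walkSum_cons, ih, hφ _ _ e]
    abel

theorem HasPotential.walkSum_eq_zero (hh : HasPotential G h) {v : V} (c : G.Walk v v) :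
    walkSum h c = 0 := by
  obtain ⟨φ, hφ⟩ := hh
  rw [walkSum_eq_sub hφ, sub_self]

theorem HasPotential.eq_of_reachable {A' B' : SimpleGraph V} {a₁ a₂ b₁ b₂ : V}
    (hh : HasPotential G h)
    (hA : A' ≤ G) (hA0 : ∀ a b, A'.Adj a b → h a b = 0) (ha : A'.Reachable a₁ a₂)
    (hB : B' ≤ G) (hB0 : ∀ a b, B'.Adj a b → h a b = 0) (hb : B'.Reachable b₁ b₂)
    (h₁ : G.Adj b₁ a₁) (h₂ : G.Adj b₂ a₂) : h b₁ a₁ = h b₂ a₂ := by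
  obtain ⟨φ, hφ⟩ := hh
  have constant {K : SimpleGraph V} (hK : K ≤ G) (hK0 : ∀ a b, K.Adj a b → h a b = 0) {u v : V}
      (huv : K.Reachable u v) : φ u = φ v :=
    eq_of_reachable_of_forall_adj
      (fun a b hab => (sub_eq_zero.1 ((hφ a b (hK hab)).symm.trans (hK0 a b hab))).symm) huv
  rw [hφ _ _ h₁, hφ _ _ h₂, constant hA hA0 ha, constant hB hB0 hb]

theorem add_walkSum_eq_zero_of_isPath (hanti : ∀ a b, h b a = -h a b)
    (hcycle : ∀ v (c : G.Walk v v), c.IsCycle → walkSum h c = 0) {u v : V} (e : G.Adj u v)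
    {p : G.Walk v u} (hp : p.IsPath) : h u v + walkSum h p = 0 := by
  by_cases he : s(u, v) ∈ p.edges
  · rw [hp.eq_adj_toWalk_of_mem_edges (Sym2.eq_swap ▸ he), Adj.toWalk, walkSum_cons, walkSum_nil,
      hanti u v]
    abel
  · rw [← walkSum_cons h e]
    exact hcycle u _ ((Walk.cons_isCycle_iff p e).2 ⟨hp, he⟩)

theorem walkSum_bypass [DecidableEq V] (hanti : ∀ a b, h b a = -h a b)
    (hcycle : ∀ v (c : G.Walk v v), c.IsCycle → walkSum h c = 0) {u v : V} (p : G.Walk u v) :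
    walkSum h p.bypass = walkSum h p := by
  induction p with
  | nil => rfl
  | @cons u v w e p ih =>
    rw [Walk.bypass, walkSum_cons, ← ih]
    split_ifs with hu
    · have hloop : h u v + walkSum h (p.bypass.takeUntil u hu) = 0 :=
        add_walkSum_eq_zero_of_isPath hanti hcycle e (p.bypass_isPath.takeUntil hu)
      conv_rhs => rw [← p.bypass.take_spec hu]
      rw [walkSum_append, ← add_assoc, hloop, zero_add]
    · rw [walkSum_cons]

theorem walkSum_eq_zero_of_forall_isCycle (hanti : ∀ a b, h b a = -h a b)
    (hcycle : ∀ v (c : G.Walk v v), c.IsCycle → walkSum h c = 0) {v : V} (c : G.Walk v v) :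
    walkSum h c = 0 := by
  classical
  rw [← walkSum_bypass hanti hcycle c, (Walk.isPath_iff_nil.1 c.bypass_isPath).eq_nil,
    walkSum_nil]

theorem hasPotential_of_forall_isCycle (hanti : ∀ a b, h b a = -h a b)
    (hcycle : ∀ v (c : G.Walk v v), c.IsCycle → walkSum h c = 0) : HasPotential G h := by
  have root (v : V) : G.Reachable (G.connectedComponentMk v).out v :=
    ConnectedComponent.eq.1 (Quot.out_eq _)
  have sum_eq {u v : V} (p q : G.Walk u v) : walkSum h p = walkSum h q := by
    have := walkSum_eq_zero_of_forall_isCycle hanti hcycle (p.append q.reverse)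
    rwa [walkSum_append, walkSum_reverse hanti, add_neg_eq_zero] at this
  refine ⟨fun v => walkSum h (root v).some, fun a b hab => eq_sub_of_add_eq' ?_⟩
  have hout : (G.connectedComponentMk a).out = (G.connectedComponentMk b).out :=
    congrArg Quot.out (ConnectedComponent.eq.2 hab.reachable)
  calc walkSum h (root a).some + h a b
      = walkSum h ((root a).some.append (Walk.cons hab Walk.nil)) := by simp
    _ = walkSum h ((root b).some.copy hout.symm rfl) := sum_eq _ _
    _ = walkSum h (root b).some := by simp [walkSum]

end Potential

theorem exists_eq_add_dir_iff {x y : Hex} : (∃ w, y = x + dir w) ↔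
    (y.1 = x.1 ∧ (y.2 = x.2 + 1 ∨ y.2 = x.2 - 1)) ∨
    (y.1 = x.1 - 1 ∧ (y.2 = x.2 + 1 ∨ y.2 = x.2)) ∨
    (y.1 = x.1 + 1 ∧ (y.2 = x.2 - 1 ∨ y.2 = x.2)) := by
  obtain ⟨p, q⟩ := x
  obtain ⟨p', q'⟩ := y
  simp only [Fin.exists_fin_succ, IsEmpty.exists_iff, dir, Prod.ext_iff, Prod.fst_add,
    Prod.snd_add, Fin.isValue, Matrix.cons_val_zero, Matrix.cons_val_one, Matrix.cons_val,
    Fin.succ_zero_eq_one, Fin.succ_one_eq_two, Fin.reduceSucc, Int.reduceNeg, add_zero, or_false]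
  omega

theorem assemblyGraph_mono {X Y : Set Hex} (h : X ⊆ Y) : assemblyGraph X ≤ assemblyGraph Y :=
  fun _ _ hab => ⟨h hab.1, h hab.2.1, hab.2.2⟩

/-- The flank on the other side. -/
def Flank.opposite : Flank → Flank
  | .left => .right
  | .right => .left

@[simp] theorem Flank.column_opposite (f : Flank) : f.opposite.column = -f.column := by
  cases f <;> rfl

theorem Flank.column_injective : Function.Injective Flank.column := by
  intro f f' h
  cases f <;> cases f' <;> simp_all [Flank.column]

theorem Flank.column_eq_or (f : Flank) : f.column = 1 ∨ f.column = -1 := by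
  cases f <;> simp [Flank.column]

/-- The number, modulo two, of crossings of the edge `a b` with the ray that leaves `y` in the
forward direction, tilted by an infinitesimal angle to the side of `f`. -/
def crossing (f : Flank) (y a b : Hex) : ZMod 2 :=
  if (a.1 = y.1 ∧ b.1 = y.1 + f.column ∧ y.2 < a.2) ∨
    (b.1 = y.1 ∧ a.1 = y.1 + f.column ∧ y.2 < b.2) then 1 else 0

theorem crossing_comm (f : Flank) (y a b : Hex) : crossing f y a b = crossing f y b a := by
  simp only [crossing, or_comm]

theorem crossing_antisymm (f : Flank) (y a b : Hex) : crossing f y b a = -crossing f y a b := by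
  rw [ZMod.neg_eq_self_mod_two, crossing_comm]

theorem crossing_of_fst_eq {f : Flank} {y a b : Hex} (ha : a.1 = y.1)
    (hb : b.1 = y.1 + f.column) : crossing f y a b = if y.2 < a.2 then 1 else 0 := by
  have := f.column_eq_or
  exact if_congr (by omega) rfl rfl

theorem crossing_eq_zero_of_fst_eq_fst {f : Flank} {y a b : Hex} (h : a.1 = b.1) :
    crossing f y a b = 0 := by
  have := f.column_eq_or
  exact if_neg (by omega)

theorem crossing_right_eq (y a b : Hex) :
    crossing .right y a b = if crossesRay y a b ∨ crossesRay y b a then 1 else 0 :=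
  if_congr Iff.rfl rfl rfl

theorem encloses_iff {G : SimpleGraph Hex} {v : Hex} {c : G.Walk v v} {y : Hex} :
    Encloses c y ↔ y ∉ c.support ∧ walkSum (crossing .right y) c = 1 := by
  refine and_congr_right fun _ => ?_
  rw [← ZMod.natCast_eq_one_iff_odd, walkSum]
  suffices ∀ l : List G.Dart, ((l.countP fun d =>
      decide (crossesRay y d.fst d.snd ∨ crossesRay y d.snd d.fst) : ℕ) : ZMod 2) =
      (l.map fun d => crossing .right y d.fst d.snd).sum by rw [this]
  intro l
  induction l with
  | nil => simp
  | cons d l ih =>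
    rw [List.countP_cons, List.map_cons, List.sum_cons, Nat.cast_add, ih, add_comm,
      crossing_right_eq]
    congr 1
    simp

theorem notMem_support_of_isCycle {X : Set Hex} {v y : Hex} {c : (assemblyGraph X).Walk v v}
    (hc : c.IsCycle) (hy : y ∉ X) : y ∉ c.support := fun hmem =>
  have ⟨_, hadj⟩ := mem_support_of_mem_walk_support c hc.not_nil hmem
  hy hadj.1

theorem hasPotential_crossing_of_forall_not_encloses {X : Set Hex} {y : Hex} (hy : y ∉ X)
    (hX : ∀ (v : Hex) (c : (assemblyGraph X).Walk v v), c.IsCycle → ¬ Encloses c y) :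
    HasPotential (assemblyGraph X) (crossing .right y) := by
  refine hasPotential_of_forall_isCycle (crossing_antisymm _ y) fun v c hc => ?_
  have hsum : walkSum (crossing .right y) c ≠ 1 := fun h1 =>
    hX v c hc (encloses_iff.2 ⟨notMem_support_of_isCycle hc hy, h1⟩)
  generalize walkSum (crossing .right y) c = s at hsum
  revert s
  decide

theorem HoleFreeShape.hasPotential_crossing {S : Set Hex} (hS : HoleFreeShape S) {y : Hex}
    (hy : y ∉ S) (f : Flank) : HasPotential (assemblyGraph S) (crossing f y) := by
  have right : HasPotential (assemblyGraph S) (crossing .right y) :=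
    hasPotential_crossing_of_forall_not_encloses hy fun v c hc he => hy (hS v c hc y he)
  cases f with
  | right => exact right
  | left =>
    -- the two tilted rays differ by the column ahead of `y`
    let φ : Hex → ZMod 2 := fun a => if a.1 = y.1 ∧ y.2 < a.2 then 1 else 0
    refine (right.add ⟨φ, fun _ _ _ => rfl⟩).congr fun a b hab => ?_
    have ha : a ≠ y := fun h => hy (h ▸ hab.1)
    have hb : b ≠ y := fun h => hy (h ▸ hab.2.1)
    have hdir := exists_eq_add_dir_iff.1 hab.2.2
    rw [ne_eq, Prod.ext_iff] at ha hb
    rw [Pi.add_apply, Pi.add_apply, crossing, crossing, Flank.column, Flank.column]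
    dsimp only [φ]
    split_ifs <;> first | omega | rfl

/-! ### Stokes' theorem on the triangular lattice of cell centres -/

/-- The sum of an edge function around the triangle `a`, `b`, `c`. -/
def circulation {V A : Type*} [AddCommGroup A] (h : V → V → A) (a b c : V) : A :=
  h a b + h b c + h c a

theorem finsum_circulation_eq_zero {A : Type*} [AddCommGroup A] {h : Hex → Hex → A}
    (hanti : ∀ a b, h b a = -h a b)
    (hfin : ∀ v, Function.HasFiniteSupport fun k => h k (k + v)) :
    ∑ᶠ k, (circulation h k (k + (0, 1)) (k + (1, 0)) +
      circulation h k (k + (1, 0)) (k + (1, -1))) = 0 := by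
  have hfin' (u v : Hex) : Function.HasFiniteSupport fun k => h (k + u) (k + u + v) :=
    (hfin v).comp_of_injective (add_left_injective u)
  have hsub (u v : Hex) : Function.HasFiniteSupport fun k =>
      h k (k + v) - h (k + u) (k + u + v) := (hfin v).sub (hfin' u v)
  have shift (u v : Hex) : ∑ᶠ k, (h k (k + v) - h (k + u) (k + u + v)) = 0 := by
    rw [finsum_sub_distrib (hfin v) (hfin' u v), sub_eq_zero]
    exact (finsum_comp_equiv (Equiv.addRight u) (f := fun k => h k (k + v))).symm
  have key (k : Hex) : circulation h k (k + (0, 1)) (k + (1, 0)) +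
      circulation h k (k + (1, 0)) (k + (1, -1)) =
      (h k (k + (0, 1)) - h (k + (1, -1)) (k + (1, -1) + (0, 1))) -
      (h k (k + (1, -1)) - h (k + (0, 1)) (k + (0, 1) + (1, -1))) := by
    have h1 : k + (1, -1) + (0, 1) = k + (1, 0) := by ext <;> simp
    have h2 : k + (0, 1) + (1, -1) = k + (1, 0) := by ext <;> simp
    rw [circulation, circulation, h1, h2, hanti k (k + (1, 0)), hanti (k + (1, -1)) (k + (1, 0)),
      hanti k (k + (1, -1))]
    abel
  rw [finsum_congr key, finsum_sub_distrib (hsub _ _) (hsub _ _), shift, shift, sub_zero]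

open Classical in
/-- The restriction of an edge function to the edges with an end in `K`. -/
noncomputable def restrictTouching {V A : Type*} [Zero A] (K : Set V) (h : V → V → A) (a b : V) :
    A :=
  if a ∈ K ∨ b ∈ K then h a b else 0

section Touching

variable {A : Type*} [AddCommGroup A] {h : Hex → Hex → A} {K B : Set Hex}

theorem circulation_restrictTouching
    (hKB : ∀ x ∈ K, ∀ w, x + dir w ∈ K ∪ B) (hB : ∀ a b, (assemblyGraph B).Adj a b → h a b = 0)
    {a b c : Hex} (hab : ∃ w, b = a + dir w) (hbc : ∃ w, c = b + dir w) (hca : ∃ w, a = c + dir w)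
    (htouch : a ∈ K ∨ b ∈ K ∨ c ∈ K) :
    circulation (restrictTouching K h) a b c = circulation h a b c := by
  have edge {x y z : Hex} (hxy : ∃ w, y = x + dir w) (hyz : ∃ w, z = y + dir w)
      (hzx : ∃ w, x = z + dir w) (hz : x ∈ K ∨ y ∈ K ∨ z ∈ K) :
      restrictTouching K h x y = h x y := by
    by_cases hxyK : x ∈ K ∨ y ∈ K
    · exact if_pos hxyK
    · have hzK : z ∈ K := by tauto
      have hx : x ∈ K ∪ B := by obtain ⟨w, rfl⟩ := hzx; exact hKB z hzK w
      have hy : y ∈ K ∪ B := by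
        obtain ⟨w, rfl⟩ := hyz
        have := hKB _ hzK (w + 3)
        rwa [dir_add_three, add_neg_cancel_right] at this
      refine (if_neg hxyK).trans (hB x y ⟨?_, ?_, hxy⟩).symm
      · exact hx.resolve_left fun h => hxyK (.inl h)
      · exact hy.resolve_left fun h => hxyK (.inr h)
  rw [circulation, circulation, edge hab hbc hca htouch, edge hbc hca hab (by tauto),
    edge hca hab hbc (by tauto)]

theorem circulation_restrictTouching_of_notMem {a b c : Hex} (ha : a ∉ K) (hb : b ∉ K)
    (hc : c ∉ K) : circulation (restrictTouching K h) a b c = 0 := by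
  simp [circulation, restrictTouching, ha, hb, hc]

theorem hasFiniteSupport_restrictTouching (hK : K.Finite) (v : Hex) :
    Function.HasFiniteSupport fun k => restrictTouching K h k (k + v) := by
  refine (hK.union (hK.image fun k => k - v)).subset fun k hk => ?_
  have hk' : k ∈ K ∨ k + v ∈ K := by_contra fun h => hk (if_neg h)
  exact hk'.imp id fun hkv => ⟨_, hkv, add_sub_cancel_right k v⟩

/-- Subtracting the coboundary of the potential makes `h` vanish between neighbours of `K`
without changing circulations; cut off outside `K`, it then has finite support. -/
theorem finsum_circulation_eq_zero_of_hasPotential (hanti : ∀ a b, h b a = -h a b)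
    (hK : K.Finite) (hKB : ∀ x ∈ K, ∀ w, x + dir w ∈ K ∪ B)
    (hB : HasPotential (assemblyGraph B) h)
    (hup : ∀ k ∉ K, circulation h k (k + (0, 1)) (k + (1, 0)) = 0)
    (hdown : ∀ k ∉ K, circulation h k (k + (1, 0)) (k + (1, -1)) = 0) :
    ∑ᶠ k, (circulation h k (k + (0, 1)) (k + (1, 0)) +
      circulation h k (k + (1, 0)) (k + (1, -1))) = 0 := by
  obtain ⟨φ, hφ⟩ := hB
  let h₀ : Hex → Hex → A := fun a b => h a b - (φ b - φ a)
  have circulation_h₀ (a b c : Hex) : circulation h₀ a b c = circulation h a b c := by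
    simp only [circulation, h₀]
    abel
  have circulation_eq {a b c : Hex} (ha : a ∉ K → circulation h a b c = 0)
      (hab : ∃ w, b = a + dir w) (hbc : ∃ w, c = b + dir w) (hca : ∃ w, a = c + dir w) :
      circulation (restrictTouching K h₀) a b c = circulation h a b c := by
    by_cases htouch : a ∈ K ∨ b ∈ K ∨ c ∈ K
    · rw [circulation_restrictTouching hKB (fun x y hxy => by simp [h₀, hφ x y hxy]) hab hbc hca
        htouch, circulation_h₀]
    · push Not at htouch
      rw [ha htouch.1, circulation_restrictTouching_of_notMem htouch.1 htouch.2.1 htouch.2.2]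
  rw [← finsum_circulation_eq_zero (h := restrictTouching K h₀) (fun a b => ?_)
    (hasFiniteSupport_restrictTouching hK)]
  · refine finsum_congr fun k => ?_
    rw [circulation_eq (hup k), circulation_eq (hdown k)] <;>
      (rw [exists_eq_add_dir_iff]; simp)
    omega
  · rw [restrictTouching, restrictTouching]
    dsimp only [h₀]
    rw [hanti a b]
    split_ifs <;> first | tauto | abel

end Touching

theorem crossing_of_fst_eq_add_one {y a b : Hex} (h : b.1 = a.1 + 1) :
    crossing .right y a b = if a.1 = y.1 ∧ y.2 < a.2 then 1 else 0 := by
  rw [crossing_right_eq]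
  exact if_congr (by unfold crossesRay; omega) rfl rfl

theorem circulation_crossing_up (y k : Hex) :
    circulation (crossing .right y) k (k + (0, 1)) (k + (1, 0)) = if k = y then 1 else 0 := by
  rw [circulation, crossing_comm _ _ (k + (1, 0)), crossing_eq_zero_of_fst_eq_fst (by simp),
    crossing_of_fst_eq_add_one (by simp), crossing_of_fst_eq_add_one (by simp)]
  dsimp only [Prod.fst_add, Prod.snd_add]
  refine .trans ?_ (if_congr Prod.ext_iff rfl rfl).symm
  split_ifs <;> first | omega | rfl

theorem circulation_crossing_down (y k : Hex) :
    circulation (crossing .right y) k (k + (1, 0)) (k + (1, -1)) = 0 := by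
  rw [circulation, crossing_comm _ _ (k + (1, -1)), crossing_of_fst_eq_add_one (by simp),
    crossing_eq_zero_of_fst_eq_fst (by simp), crossing_of_fst_eq_add_one (by simp), add_zero]
  exact CharTwo.add_self_eq_zero _

theorem perimeter_subset (S : Set Hex) : perimeter S ⊆ S := fun _ hx => hx.1

theorem subset_target_perimeter {S : Set Hex} (hfin : S.Finite) : S ⊆ target (perimeter S) := by
  intro y hyS
  by_contra hy
  have hyB : y ∉ perimeter S := fun h => hy (.inl h)
  have hpot : HasPotential (assemblyGraph (perimeter S)) (crossing .right y) :=
    hasPotential_crossing_of_forall_not_encloses hyB fun v c hc he => hy (.inr ⟨v, c, hc, he⟩)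
  have hnear : ∀ x ∈ S \ perimeter S, ∀ w, x + dir w ∈ S \ perimeter S ∪ perimeter S := by
    intro x hx w
    rw [Set.sdiff_union_of_subset (perimeter_subset S)]
    by_contra h
    exact hx.2 ⟨hx.1, w, h⟩
  have hsum := finsum_circulation_eq_zero_of_hasPotential (crossing_antisymm _ y)
    hfin.sdiff hnear hpot
    (fun k hk => by rw [circulation_crossing_up, if_neg (by rintro rfl; exact hk ⟨hyS, hyB⟩)])
    (fun k _ => circulation_crossing_down y k)
  simp only [circulation_crossing_up, circulation_crossing_down, add_zero] at hsum
  rw [finsum_eq_single _ y fun k hk => if_neg hk, if_pos rfl] at hsum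
  exact one_ne_zero hsum

theorem target_perimeter_subset {S : Set Hex} (hS : HoleFreeShape S) :
    target (perimeter S) ⊆ S := by
  rintro y (hy | ⟨v, c, hc, hy⟩)
  · exact hy.1
  · have hle := assemblyGraph_mono (perimeter_subset S)
    refine hS v (c.mapLe hle) (hc.mapLe hle) y (encloses_iff.2 ?_)
    rw [encloses_iff] at hy
    simpa [walkSum, Function.comp_def] using hy

theorem target_perimeter {S : Set Hex} (hfin : S.Finite) (hS : HoleFreeShape S) :
    target (perimeter S) = S :=
  (target_perimeter_subset hS).antisymm (subset_target_perimeter hfin)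

theorem exists_ordConnectedComponent_eq_Ioo {C : Set ℤ} (hC : C.Finite) {q : ℤ} (hq : q ∈ C) :
    ∃ l u, l ∉ C ∧ u ∉ C ∧ C.ordConnectedComponent q = Set.Ioo l u := by
  obtain ⟨u, ⟨hqu, hu⟩, hu_least⟩ := Int.exists_least_of_bdd (P := fun k => q < k ∧ k ∉ C)
    ⟨q, fun _ hk => hk.1.le⟩ ((Set.Ioi_infinite q).exists_notMem_finite hC)
  obtain ⟨l, ⟨hlq, hl⟩, hl_greatest⟩ := Int.exists_greatest_of_bdd (P := fun k => k < q ∧ k ∉ C)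
    ⟨q, fun _ hk => hk.1.le⟩ ((Set.Iio_infinite q).exists_notMem_finite hC)
  have hIoo : Set.Ioo l u ⊆ C := fun k hk => by
    by_contra hkC
    rcases lt_trichotomy k q with h | rfl | h
    · exact (hl_greatest k ⟨h, hkC⟩).not_gt hk.1
    · exact hkC hq
    · exact (hu_least k ⟨h, hkC⟩).not_gt hk.2
  refine ⟨l, u, hl, hu, Set.Subset.antisymm (fun r hr => ?_) fun r hr =>
    (Set.ordConnected_Ioo.uIcc_subset ⟨hlq, hqu⟩ hr).trans hIoo⟩
  by_contra hr'
  rw [Set.mem_Ioo, not_and_or, not_lt, not_lt] at hr'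
  rcases hr' with h | h
  · exact hl (hr (Set.mem_uIcc_of_ge h hlq.le))
  · exact hu (hr (Set.mem_uIcc_of_le hqu.le h))

/-- The column segment of `S` through `x`: the cells of the column of `x` that are joined to `x`
by consecutive cells of `S` in that column. It is empty unless `x ∈ S`. -/
def segment (S : Set Hex) (x : Hex) : Set Hex :=
  {y | y.1 = x.1 ∧ y.2 ∈ (Prod.mk x.1 ⁻¹' S).ordConnectedComponent x.2}

section Segment

variable {S T : Set Hex} {x y z : Hex}

@[simp] theorem self_mem_segment : x ∈ segment S x ↔ x ∈ S := by
  simp [segment]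

theorem segment_subset : segment S x ⊆ S := by
  rintro ⟨_, r⟩ ⟨rfl, hr⟩
  exact hr Set.right_mem_uIcc

theorem segment_mono (h : S ⊆ T) : segment S x ⊆ segment T x :=
  fun _ hy => ⟨hy.1, hy.2.trans (Set.preimage_mono h)⟩

theorem mem_segment_comm : y ∈ segment S x ↔ x ∈ segment S y := by
  suffices ∀ {x y : Hex}, y ∈ segment S x → x ∈ segment S y from ⟨this, this⟩
  rintro ⟨_, q⟩ ⟨_, r⟩ ⟨rfl, hr⟩
  exact ⟨rfl, Set.mem_ordConnectedComponent_comm.1 hr⟩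

theorem mem_segment_trans (hxy : y ∈ segment S x) (hyz : z ∈ segment S y) :
    z ∈ segment S x := by
  obtain ⟨_, q⟩ := x
  obtain ⟨_, r⟩ := y
  obtain ⟨rfl, hr⟩ := hxy
  exact ⟨hyz.1, Set.mem_ordConnectedComponent_trans hr hyz.2⟩

theorem mem_of_mem_segment (h : y ∈ segment S x) : x ∈ S :=
  segment_subset (mem_segment_comm.1 h)

theorem segment_eq (h : y ∈ segment S x) : segment S y = segment S x :=
  Set.ext fun _ => ⟨mem_segment_trans h, mem_segment_trans (mem_segment_comm.1 h)⟩

theorem mem_segment_of_abs_sub_le_one (hx : x ∈ S) (hy : y ∈ S) (h : y.1 = x.1)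
    (hle : |y.2 - x.2| ≤ 1) : y ∈ segment S x := by
  refine ⟨h, fun k hk => ?_⟩
  rw [abs_le] at hle
  rw [Set.mem_uIcc] at hk
  obtain rfl | rfl : k = x.2 ∨ k = y.2 := by omega
  · exact hx
  · exact h ▸ hy

theorem mem_segment_of_adj_of_fst_eq (h : (assemblyGraph S).Adj x y) (hfst : y.1 = x.1) :
    y ∈ segment S x := by
  refine mem_segment_of_abs_sub_le_one h.1 h.2.1 hfst ?_
  have := exists_eq_add_dir_iff.1 h.2.2
  rw [abs_le]
  omega

theorem lt_of_notMem_of_lt {k : ℤ} (hk : (x.1, k) ∉ S) (hxk : x.2 < k) (hy : y ∈ segment S x) :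
    y.2 < k := by
  by_contra h
  exact hk (hy.2 (Set.mem_uIcc_of_le hxk.le (not_lt.1 h)))

theorem gt_of_notMem_of_gt {k : ℤ} (hk : (x.1, k) ∉ S) (hxk : k < x.2) (hy : y ∈ segment S x) :
    k < y.2 := by
  by_contra h
  exact hk (hy.2 (Set.mem_uIcc_of_ge (not_lt.1 h) hxk.le))

theorem exists_segment_bounds (hfin : S.Finite) (hx : x ∈ S) :
    ∃ l u, (x.1, l) ∉ S ∧ (x.1, u) ∉ S ∧
      ∀ y, y ∈ segment S x ↔ y.1 = x.1 ∧ l < y.2 ∧ y.2 < u := by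
  obtain ⟨l, u, hl, hu, heq⟩ := exists_ordConnectedComponent_eq_Ioo
    (hfin.preimage (Prod.mk_right_injective x.1).injOn) (q := x.2) hx
  exact ⟨l, u, hl, hu, fun y => by rw [segment, heq]; rfl⟩

theorem reachable_of_mem_segment (h : y ∈ segment S x) :
    (assemblyGraph (segment S x)).Reachable x y := by
  obtain ⟨_, q⟩ := x
  obtain ⟨p, r⟩ := y
  obtain ⟨rfl, hr⟩ := h
  have mem (i : ℤ) (hi : i ∈ Set.uIcc q r) : (p, i) ∈ segment S (p, q) :=
    ⟨rfl, (Set.uIcc_subset_uIcc_left hi).trans hr⟩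
  have adj (i : ℤ) (hi : i ∈ Set.uIcc q r) (hi' : i + 1 ∈ Set.uIcc q r) :
      (assemblyGraph (segment S (p, q))).Adj (p, i) (p, i + 1) :=
    ⟨mem i hi, mem _ hi', exists_eq_add_dir_iff.2 (.inl ⟨rfl, .inl rfl⟩)⟩
  rw [reachable_iff_reflTransGen]
  refine Relation.ReflTransGen.lift (Prod.mk p) (fun _ _ => id) _ _ (reflTransGen_of_succ
    (fun i j => (assemblyGraph (segment S (p, q))).Adj (p, i) (p, j))
    (fun i hi => adj i ?_ ?_) fun i hi => (adj i ?_ ?_).symm)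
  all_goals
    rw [Set.mem_Ico] at hi
    rw [Set.mem_uIcc]
    omega

end Segment

theorem crossing_congr {f : Flank} {y z a b : Hex} (hz : z.1 = y.1)
    (ha : a.1 = y.1 → (y.2 < a.2 ↔ z.2 < a.2)) (hb : b.1 = y.1 → (y.2 < b.2 ↔ z.2 < b.2)) :
    crossing f y a b = crossing f z a b :=
  if_congr (by rw [hz]; tauto) rfl rfl

/-! ### A hole-free shape is a tree of segments -/

section Separation

variable {S : Set Hex} {a a₁ a₂ b b₁ b₂ : Hex}

theorem lt_or_lt_of_notMem_segment {x y : Hex} {l u : ℤ} (hl : (x.1, l) ∉ S) (hu : (x.1, u) ∉ S)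
    (hseg : ∀ z, z ∈ segment S x ↔ z.1 = x.1 ∧ l < z.2 ∧ z.2 < u) (hy : y ∈ S)
    (hyx : y ∉ segment S x) (hfst : y.1 = x.1) : y.2 < l ∨ u < y.2 := by
  have hyl : y.2 ≠ l := fun h => hl (h ▸ hfst ▸ hy)
  have hyu : y.2 ≠ u := fun h => hu (h ▸ hfst ▸ hy)
  have := mt (hseg y).2 hyx
  omega

theorem HasPotential.eq_of_reachable_sdiff_segment {A : Type*} [AddCommGroup A]
    {h : Hex → Hex → A} (hh : HasPotential (assemblyGraph S) h)
    (hcol : ∀ a b, a.1 = b.1 → h a b = 0)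
    (hout : ∀ a b, (assemblyGraph (S \ segment S b₁)).Adj a b → h a b = 0)
    (hb : b₂ ∈ segment S b₁) (e₁ : (assemblyGraph S).Adj b₁ a₁) (e₂ : (assemblyGraph S).Adj b₂ a₂)
    (hr : (assemblyGraph (S \ segment S b₁)).Reachable a₁ a₂) : h b₁ a₁ = h b₂ a₂ :=
  hh.eq_of_reachable (assemblyGraph_mono Set.sdiff_subset) hout hr
    (assemblyGraph_mono segment_subset) (fun a b hab => hcol a b (hab.1.1.trans hab.2.1.1.symm))
    (reachable_of_mem_segment hb) e₁ e₂

theorem crossing_add_crossing_eq_zero_of_fst_eq_fst {f g : Flank} {y z : Hex} (a b : Hex)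
    (h : a.1 = b.1) : (crossing f y + crossing g z) a b = 0 := by
  rw [Pi.add_apply, Pi.add_apply, crossing_eq_zero_of_fst_eq_fst h,
    crossing_eq_zero_of_fst_eq_fst h, add_zero]

theorem fst_eq_add_column_of_reachable (hfin : S.Finite) (hS : HoleFreeShape S)
    (hb : b₂ ∈ segment S b₁) (e₁ : (assemblyGraph S).Adj b₁ a₁) (e₂ : (assemblyGraph S).Adj b₂ a₂)
    (hr : (assemblyGraph (S \ segment S b₁)).Reachable a₁ a₂) {f : Flank}
    (h₁ : a₁.1 = b₁.1 + f.column) : a₂.1 = b₁.1 + f.column := by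
  obtain ⟨l, u, hl, hu, hseg⟩ := exists_segment_bounds hfin e₁.1
  have h₁b := (hseg b₁).1 (self_mem_segment.2 e₁.1)
  have key := ((hS.hasPotential_crossing hl f).add
    (hS.hasPotential_crossing hu f)).eq_of_reachable_sdiff_segment
    crossing_add_crossing_eq_zero_of_fst_eq_fst (fun a b hab => ?_) hb e₁ e₂ hr
  · have weight₁ : (crossing f (b₁.1, l) + crossing f (b₁.1, u)) b₁ a₁ = 1 := by
      rw [Pi.add_apply, Pi.add_apply, crossing_of_fst_eq (y := (b₁.1, l)) (a := b₁) rfl h₁,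
        crossing_of_fst_eq (y := (b₁.1, u)) (a := b₁) rfl h₁, if_pos h₁b.2.1, if_neg h₁b.2.2.not_gt,
        add_zero]
    have outside (k : ℤ) (h₂ : a₂.1 ≠ b₁.1 + f.column) : crossing f (b₁.1, k) b₂ a₂ = 0 := by
      have := hb.1
      have := f.column_eq_or
      refine if_neg ?_
      dsimp only
      omega
    by_contra h₂
    rw [weight₁, Pi.add_apply, Pi.add_apply, outside l h₂, outside u h₂] at key
    exact one_ne_zero key
  · have ha := lt_or_lt_of_notMem_segment hl hu hseg hab.1.1 hab.1.2
    have hb := lt_or_lt_of_notMem_segment hl hu hseg hab.2.1.1 hab.2.1.2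
    have congr : crossing f (b₁.1, l) a b = crossing f (b₁.1, u) a b :=
      crossing_congr rfl (by dsimp only; omega) (by dsimp only; omega)
    rw [Pi.add_apply, Pi.add_apply, congr, CharTwo.add_self_eq_zero]

theorem crossing_eq_crossing_opposite {f : Flank} {x : Hex} {l u k : ℤ} (hl : (x.1, l) ∉ S)
    (hu : (x.1, u) ∉ S) (hseg : ∀ z, z ∈ segment S x ↔ z.1 = x.1 ∧ l < z.2 ∧ z.2 < u)
    (hlk : l ≤ k) (hku : k < u) (h : (assemblyGraph (S \ segment S x)).Adj a b) :
    crossing f (x.1, u) a b = crossing f.opposite (x.1 + f.column, k) a b := by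
  have ha := lt_or_lt_of_notMem_segment hl hu hseg h.1.1 h.1.2
  have hb := lt_or_lt_of_notMem_segment hl hu hseg h.2.1.1 h.2.1.2
  have hd := exists_eq_add_dir_iff.1 h.2.2
  have hf := f.column_eq_or
  refine if_congr ?_ rfl rfl
  dsimp only
  rw [Flank.column_opposite]
  omega

theorem mk_mem_of_reachable (hfin : S.Finite) (hS : HoleFreeShape S)
    (hb : b₂ ∈ segment S b₁) (e₁ : (assemblyGraph S).Adj b₁ a₁) (e₂ : (assemblyGraph S).Adj b₂ a₂)
    (hr : (assemblyGraph (S \ segment S b₁)).Reachable a₁ a₂) {f : Flank}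
    (h₁ : a₁.1 = b₁.1 + f.column) (h₂ : a₂.1 = b₁.1 + f.column) {k : ℤ}
    (hk : k ∈ Set.uIcc a₁.2 a₂.2) : (a₁.1, k) ∈ S := by
  by_contra hkS
  have hk₁ : k ≠ a₁.2 := fun h => hkS (h ▸ e₁.2.1)
  have hk₂ : k ≠ a₂.2 := fun h => hkS (h ▸ h₁.trans h₂.symm ▸ e₂.2.1)
  rw [Set.mem_uIcc] at hk
  obtain ⟨l, u, hl, hu, hseg⟩ := exists_segment_bounds hfin e₁.1
  have h₁b := (hseg b₁).1 (self_mem_segment.2 e₁.1)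
  have h₂b := (hseg b₂).1 hb
  have key := ((hS.hasPotential_crossing hu f).add
    (hS.hasPotential_crossing hkS f.opposite)).eq_of_reachable_sdiff_segment
    crossing_add_crossing_eq_zero_of_fst_eq_fst (fun a b hab => ?_) hb e₁ e₂ hr
  · have weight {a c : Hex} (hc : c ∈ segment S b₁) (ha : a.1 = b₁.1 + f.column) :
        (crossing f (b₁.1, u) + crossing f.opposite (a₁.1, k)) c a =
          if k < a.2 then 1 else 0 := by
      rw [hseg] at hc
      rw [Pi.add_apply, Pi.add_apply, crossing_of_fst_eq (y := (b₁.1, u)) hc.1 ha,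
        if_neg hc.2.2.not_gt, zero_add, crossing_comm,
        crossing_of_fst_eq (y := (a₁.1, k)) (ha.trans h₁.symm) (by simp [h₁, hc.1])]
    rw [weight (self_mem_segment.2 e₁.1) h₁, weight hb h₂] at key
    rcases hk with hk | hk
    · rw [if_neg (by omega), if_pos (by omega)] at key
      exact zero_ne_one key
    · rw [if_pos (by omega), if_neg (by omega)] at key
      exact one_ne_zero key
  · have hd₁ := exists_eq_add_dir_iff.1 e₁.2.2
    have hd₂ := exists_eq_add_dir_iff.1 e₂.2.2
    have hf := f.column_eq_or
    have hlk : l ≤ k := by omega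
    have hku : k < u := by omega
    rw [Pi.add_apply, Pi.add_apply, h₁, crossing_eq_crossing_opposite hl hu hseg hlk hku hab,
      CharTwo.add_self_eq_zero]

theorem exists_fst_eq_add_column (h : (assemblyGraph S).Adj a b) (hne : b.1 ≠ a.1) :
    ∃ f : Flank, b.1 = a.1 + f.column := by
  rcases exists_eq_add_dir_iff.1 h.2.2 with h | h | h
  · exact absurd h.1 hne
  · exact ⟨.left, h.1⟩
  · exact ⟨.right, h.1⟩

theorem mem_segment_of_reachable (hfin : S.Finite) (hS : HoleFreeShape S)
    (hb : b₂ ∈ segment S b₁) (e₁ : (assemblyGraph S).Adj b₁ a₁) (e₂ : (assemblyGraph S).Adj b₂ a₂)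
    (hr : (assemblyGraph (S \ segment S b₁)).Reachable a₁ a₂) (hne : a₁.1 ≠ b₁.1) :
    a₂ ∈ segment S a₁ := by
  obtain ⟨f, h₁⟩ := exists_fst_eq_add_column e₁ hne
  have h₂ := fst_eq_add_column_of_reachable hfin hS hb e₁ e₂ hr h₁
  exact ⟨h₂.trans h₁.symm, fun _ => mk_mem_of_reachable hfin hS hb e₁ e₂ hr h₁ h₂⟩

end Separation

section Precedes

variable {S X A : Set Hex} {r a a' b b' x y : Hex}

theorem exists_adj_of_reachable (h : (assemblyGraph X).Reachable r x) (hr : r ∉ A) (hx : x ∈ A) :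
    ∃ a b, a ∉ A ∧ b ∈ A ∧ (assemblyGraph X).Adj a b ∧
      (assemblyGraph (X \ A)).Reachable r a := by
  obtain ⟨p⟩ := h
  induction p with
  | nil => exact absurd hx hr
  | @cons r v x e _ ih =>
    by_cases hv : v ∈ A
    · exact ⟨r, v, hr, hv, e, .rfl⟩
    · obtain ⟨a, b, ha, hb, hab, hva⟩ := ih hv hx
      have hrv : (assemblyGraph (X \ A)).Adj r v := ⟨⟨e.1, hr⟩, ⟨e.2.1, hv⟩, e.2.2⟩
      exact ⟨a, b, ha, hb, hab, hrv.reachable.trans hva⟩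

/-- The cell `a` is connected to the root `r` outside the segment of `b`. For neighbours `a`, `b` in
different columns this says that the segment of `a` is the parent of that of `b` in the tree of
segments rooted at `r`. -/
def Precedes (S : Set Hex) (r a b : Hex) : Prop :=
  r ∉ segment S b ∧ (assemblyGraph (S \ segment S b)).Reachable r a

theorem segment_subset_sdiff_segment (hab : a.1 ≠ b.1) : segment S a ⊆ S \ segment S b :=
  fun _ hc => ⟨segment_subset hc, fun hcb => hab (hc.1.symm.trans hcb.1)⟩

theorem Precedes.congr_left (h : Precedes S r a b) (ha : a' ∈ segment S a) (hab : a.1 ≠ b.1) :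
    Precedes S r a' b :=
  ⟨h.1, h.2.trans ((reachable_of_mem_segment ha).mono
    (assemblyGraph_mono (segment_subset_sdiff_segment hab)))⟩

theorem Precedes.congr_right (h : Precedes S r a b) (hb : b' ∈ segment S b) :
    Precedes S r a b' := by
  rwa [Precedes, segment_eq hb]

theorem Precedes.mem_segment (hfin : S.Finite) (hS : HoleFreeShape S) (h : Precedes S r a b)
    (h' : Precedes S r a' b') (hb : b' ∈ segment S b) (e : (assemblyGraph S).Adj b a)
    (e' : (assemblyGraph S).Adj b' a') (hab : a.1 ≠ b.1) : a' ∈ segment S a :=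
  mem_segment_of_reachable hfin hS hb e e'
    (h.2.symm.trans (h'.congr_right (mem_segment_comm.1 hb)).2) hab

theorem precedes_of_disjoint (hX : X ⊆ S) (hr : r ∈ X) (hx : (assemblyGraph X).Reachable r x)
    (hd : ∀ c ∈ X, c ∉ segment S b) : Precedes S r x b :=
  ⟨hd r hr, hx.mono (assemblyGraph_mono fun c hc => ⟨hX hc, hd c hc⟩)⟩

theorem precedes_or_precedes (e : (assemblyGraph S).Adj x y) (hxy : x.1 ≠ y.1)
    (hr : (assemblyGraph S).Reachable r x) : Precedes S r x y ∨ Precedes S r y x := by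
  have left {b : Hex} (hb : b ∈ segment S x) (h : Precedes S r b y) : Precedes S r x y :=
    h.congr_left (mem_segment_comm.1 hb) (hb.1 ▸ hxy)
  have right {b : Hex} (hb : b ∈ segment S y) (h : Precedes S r b x) : Precedes S r y x :=
    h.congr_left (mem_segment_comm.1 hb) (hb.1 ▸ hxy.symm)
  by_cases hrx : r ∈ segment S x
  · exact .inl (left hrx ⟨(segment_subset_sdiff_segment hxy hrx).2, .rfl⟩)
  by_cases hry : r ∈ segment S y
  · exact .inr (right hry ⟨hrx, .rfl⟩)
  obtain ⟨a, b, ha, hb, hab, hra⟩ := exists_adj_of_reachable (A := segment S x ∪ segment S y) hr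
    (fun h => h.elim hrx hry) (.inl (self_mem_segment.2 e.1))
  rw [Set.mem_union, not_or] at ha
  have reach {c : Hex} (hc : segment S c ⊆ segment S x ∪ segment S y) (hac : a ∉ segment S c)
      (hbc : b ∉ segment S c) : (assemblyGraph (S \ segment S c)).Reachable r b :=
    have hab' : (assemblyGraph (S \ segment S c)).Adj a b :=
      ⟨⟨hab.1, hac⟩, ⟨hab.2.1, hbc⟩, hab.2.2⟩
    (hra.mono (assemblyGraph_mono (Set.sdiff_subset_sdiff_right hc))).trans hab'.reachable
  rcases hb with hb | hb
  · exact .inl (left hb ⟨hry, reach Set.subset_union_right ha.2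
      (segment_subset_sdiff_segment hxy hb).2⟩)
  · exact .inr (right hb ⟨hrx, reach Set.subset_union_left ha.1
      (segment_subset_sdiff_segment hxy.symm hb).2⟩)

theorem exists_precedes (hX : X ⊆ S) (h : (assemblyGraph X).Reachable r x) (hx : x ∈ S)
    (hrx : r ∉ segment S x) : ∃ a b, b ∈ X ∧ b ∈ segment S x ∧ (assemblyGraph S).Adj b a ∧
      a.1 ≠ b.1 ∧ Precedes S r a b := by
  obtain ⟨a, b, ha, hb, hab, hra⟩ := exists_adj_of_reachable h hrx (self_mem_segment.2 hx)
  have hba := assemblyGraph_mono hX hab.symm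
  refine ⟨a, b, hab.2.1, hb, hba, fun hfst => ?_, ?_⟩
  · exact ha (mem_segment_trans hb (mem_segment_of_adj_of_fst_eq hba hfst))
  · rw [Precedes, segment_eq hb]
    exact ⟨hrx, hra.mono (assemblyGraph_mono (Set.sdiff_subset_sdiff_left hX))⟩

end Precedes

/-! ### Walls and flanks -/

section Walls

variable {f : Flank} {w v : Wall} {x : Hex}

/-- The wall of flank `f` that is adjacent to the fore-aft wall `v`. -/
def Flank.side : Flank → Wall → Wall
  | .left, v => if v = 0 then 1 else 2
  | .right, v => if v = 0 then 5 else 4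

theorem side_mem_walls (f : Flank) (v : Wall) : f.side v ∈ f.walls := by
  cases f <;> rw [Flank.side] <;> split_ifs <;> simp [Flank.walls]

theorem dir_side (f : Flank) (hv : v ∈ foreAft) :
    dir (f.side v) = dir v + dir (f.side (v + 3)) := by
  cases f <;> rcases hv with rfl | rfl <;> decide

theorem eq_side_or_eq_side (hw : w ∈ f.walls) (hv : v ∈ foreAft) :
    w = f.side v ∨ w = f.side (v + 3) := by
  cases f <;> rcases hv with rfl | rfl <;> rcases hw with rfl | rfl <;> decide

theorem exists_mem_walls_of_notMem_foreAft (hw : w ∉ foreAft) : ∃ f : Flank, w ∈ f.walls := by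
  fin_cases w
  · exact absurd (.inl rfl) hw
  · exact ⟨.left, .inl rfl⟩
  · exact ⟨.left, .inr rfl⟩
  · exact absurd (.inr rfl) hw
  · exact ⟨.right, .inl rfl⟩
  · exact ⟨.right, .inr rfl⟩

theorem exists_foreAft_eq_side (hw : w ∈ f.walls) : ∃ v ∈ foreAft, w = f.side v ∧
    (w + 1 = v ∧ w - 1 = f.side (v + 3) ∨ w - 1 = v ∧ w + 1 = f.side (v + 3)) := by
  cases f <;> rcases hw with rfl | rfl
  · exact ⟨0, .inl rfl, by decide⟩
  · exact ⟨3, .inr rfl, by decide⟩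
  · exact ⟨3, .inr rfl, by decide⟩
  · exact ⟨0, .inl rfl, by decide⟩

theorem add_three_mem_walls_opposite (hw : w ∈ f.walls) : w + 3 ∈ f.opposite.walls := by
  cases f <;> rcases hw with rfl | rfl <;> simp [Flank.opposite, Flank.walls]

theorem fst_add_dir (hw : w ∈ f.walls) : (x + dir w).1 = x.1 + f.column := by
  cases f <;> rcases hw with rfl | rfl <;> rfl

theorem fst_add_dir_ne (hw : w ∈ f.walls) : (x + dir w).1 ≠ x.1 := by
  have := f.column_eq_or
  rw [fst_add_dir hw]
  omega

theorem mem_walls_of_fst_add_dir (h : (x + dir w).1 = x.1 + f.column) : w ∈ f.walls := by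
  cases f <;> fin_cases w <;> simp_all [dir, Flank.column, Flank.walls]

theorem add_dir_add_dir_add_three (x : Hex) (w : Wall) : x + dir w + dir (w + 3) = x := by
  rw [dir_add_three, add_neg_cancel_right]

theorem adj_add_dir {S : Set Hex} (hx : x ∈ S) (hw : x + dir w ∈ S) :
    (assemblyGraph S).Adj x (x + dir w) :=
  ⟨hx, hw, w, rfl⟩

theorem add_dir_mem_segment {S : Set Hex} (hv : v ∈ foreAft) (hx : x ∈ S) (h : x + dir v ∈ S) :
    x + dir v ∈ segment S x :=
  mem_segment_of_adj_of_fst_eq (adj_add_dir hx h) (by rcases hv with rfl | rfl <;> simp [dir])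

theorem add_dir_mem_segment_add_dir {S : Set Hex} {w' : Wall} (hw : w ∈ f.walls)
    (hw' : w' ∈ f.walls) (h : x + dir w ∈ S) (h' : x + dir w' ∈ S) :
    x + dir w' ∈ segment S (x + dir w) := by
  refine mem_segment_of_abs_sub_le_one h h' ((fst_add_dir hw').trans (fst_add_dir hw).symm) ?_
  cases f <;> rcases hw with rfl | rfl <;> rcases hw' with rfl | rfl <;> simp [dir]

theorem snd_le_of_add_dir_zero_notMem {S : Set Hex} {y : Hex} (h : x + dir 0 ∉ S)
    (hy : y ∈ segment S x) : y.2 ≤ x.2 :=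
  Int.lt_add_one_iff.1 (lt_of_notMem_of_lt (by simpa [dir, Prod.add_def] using h) (lt_add_one _) hy)

theorem snd_le_of_add_dir_three_notMem {S : Set Hex} {y : Hex} (h : x + dir 3 ∉ S)
    (hy : y ∈ segment S x) : x.2 ≤ y.2 :=
  Int.sub_one_lt_iff.1 (gt_of_notMem_of_gt
    (by simpa [dir, Prod.add_def, sub_eq_add_neg] using h) (sub_one_lt _) hy)

theorem snd_mem_uIcc_of_add_dir_notMem {S : Set Hex} {y : Hex} (hv : v ∈ foreAft)
    (h : x + dir (f.side v) + dir (v + 3) ∉ S) (hw : w ∈ f.walls)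
    (hy : y + dir w ∈ segment S (x + dir (f.side v))) :
    x.2 ∈ Set.uIcc (x + dir (v + 3)).2 y.2 := by
  rcases hv with rfl | rfl
  · have hle := snd_le_of_add_dir_three_notMem h hy
    rw [Set.mem_uIcc]
    cases f <;> rcases hw with rfl | rfl <;> dsimp [dir, Flank.side] at hle ⊢ <;> omega
  · have hle := snd_le_of_add_dir_zero_notMem h hy
    rw [Set.mem_uIcc]
    cases f <;> rcases hw with rfl | rfl <;> dsimp [dir, Flank.side] at hle ⊢ <;> omega

theorem add_dir_eq_or (hw : w ∈ f.walls) {w' : Wall} (hw' : w' ∈ f.walls) (x : Hex) :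
    x + dir w' = x + dir w ∨ ∃ v ∈ foreAft, x + dir w' = x + dir w + dir v := by
  obtain ⟨v, hv, rfl, -⟩ := exists_foreAft_eq_side hw'
  rcases eq_side_or_eq_side hw hv with rfl | rfl
  · exact .inl rfl
  · exact .inr ⟨v, hv, by rw [dir_side f hv, add_assoc, add_comm (dir v)]⟩

end Walls

/-! ### Nucleation sites -/

section Nucleation

variable {Xb V : Set Hex} {x x' : Hex} {w w' v : Wall} {f : Flank}

theorem status_eq_free :
    status Xb V x w = .free ↔ x + dir w ∈ target Xb ∧ x + dir w ∉ V := by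
  rw [status]
  split_ifs <;> simp_all

theorem status_eq_occupied :
    status Xb V x w = .occupied ↔ x + dir w ∈ target Xb ∧ x + dir w ∈ V := by
  rw [status]
  split_ifs <;> simp_all

theorem status_eq_null : status Xb V x w = .null ↔ x + dir w ∉ target Xb := by
  rw [status]
  split_ifs <;> simp_all

/-- A cell whose robot may set the flag of flank `f`: either a wall `f.side v` of that flank faces
a target cell and both its neighbours, `v` and `f.side (v + 3)`, are null, or the row of the cell
is the one selected from the facing column. -/
def IsNucleationSite (Xb : Set Hex) (x : Hex) (f : Flank) : Prop :=
  (∃ v ∈ foreAft, x + dir (f.side v) ∈ target Xb ∧ x + dir v ∉ target Xb ∧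
    x + dir (f.side (v + 3)) ∉ target Xb) ∨
  roleFromColumn Xb x f = true

theorem isNucleationSite_of_nucleates (h : nucleates Xb V x f = true) :
    IsNucleationSite Xb x f := by
  rw [nucleates, roleFromSelf] at h
  split_ifs at h with hfree hnull
  · obtain ⟨w, hw, hfree, hnull⟩ := hnull
    obtain ⟨v, hv, rfl, ⟨h₁, h₂⟩ | ⟨h₁, h₂⟩⟩ := exists_foreAft_eq_side hw <;>
      rw [h₁, h₂, status_eq_null, status_eq_null] at hnull
    · exact .inl ⟨v, hv, (status_eq_free.1 hfree).1, hnull⟩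
    · exact .inl ⟨v, hv, (status_eq_free.1 hfree).1, hnull.symm⟩
  · exact .inr h
  · exact absurd h Bool.false_ne_true

theorem nucleates_eq_false (h : ∀ w ∈ f.walls, x + dir w ∈ target Xb → x + dir w ∈ V) :
    nucleates Xb V x f = false := by
  rw [nucleates, roleFromSelf, if_neg, Option.getD_some]
  rintro ⟨w, hw, hfree⟩
  rw [status_eq_free] at hfree
  exact hfree.2 (h w hw hfree.1)

theorem eq_of_isolated_contact (hv : v ∈ foreAft) (h₀ : x + dir (f.side v) ∈ target Xb)
    (h₁ : x + dir v ∉ target Xb) (h₂ : x + dir (f.side (v + 3)) ∉ target Xb)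
    (hx' : x' ∈ segment (target Xb) x) (hw : w ∈ f.walls) (hw' : w' ∈ f.walls)
    (hxw' : x' + dir w' ∈ segment (target Xb) (x + dir w)) : x' = x := by
  rw [← segment_eq (add_dir_mem_segment_add_dir hw (side_mem_walls f v) (mem_of_mem_segment hxw')
    h₀)] at hxw'
  have dir_side_add_three : dir (f.side (v + 3)) = dir (f.side v) + dir (v + 3) := by
    rw [dir_side f hv, dir_add_three]
    abel
  rw [dir_side_add_three, ← add_assoc] at h₂
  have hle := snd_mem_uIcc_of_add_dir_notMem hv h₂ hw' hxw'
  refine Prod.ext hx'.1 ?_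
  rcases hv with rfl | rfl
  · have hge := snd_le_of_add_dir_zero_notMem h₁ hx'
    change x.2 ∈ Set.uIcc (x.2 + -1) _ at hle
    rw [Set.mem_uIcc] at hle
    omega
  · have hge := snd_le_of_add_dir_three_notMem h₁ hx'
    change x.2 ∈ Set.uIcc (x.2 + 1) _ at hle
    rw [Set.mem_uIcc] at hle
    omega

theorem segmentRows_eq (h : x' ∈ segment (target Xb) x) :
    segmentRows Xb x' = segmentRows Xb x := by
  have mem_iff (y : Hex) (r : ℤ) : r ∈ segmentRows Xb y ↔ (y.1, r) ∈ segment (target Xb) y :=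
    ⟨fun hr => ⟨rfl, hr⟩, And.right⟩
  ext r
  rw [mem_iff, mem_iff, segment_eq h, h.1]

theorem facingRows_eq (hw : w ∈ f.walls) (h : x + dir w ∈ target Xb) :
    facingRows Xb x f = segmentRows Xb (x + dir w) := by
  ext r
  constructor
  · rintro ⟨w', hw', h', hr⟩
    rwa [← segmentRows_eq (add_dir_mem_segment_add_dir hw hw' h h')]
  · exact fun hr => ⟨w, hw, h, hr⟩

theorem roleFromColumn_eq_true (h : roleFromColumn Xb x f = true) :
    x.2 = midRow (facingRows Xb x f) ∨
      midRow (facingRows Xb x f) ∉ segmentRows Xb x ∧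
      x.2 ∈ facingRows Xb x f ∩ segmentRows Xb x ∧
      ∀ k ∈ facingRows Xb x f ∩ segmentRows Xb x,
        |x.2 - midRow (facingRows Xb x f)| ≤ |k - midRow (facingRows Xb x f)| := by
  simp only [roleFromColumn] at h
  split_ifs at h with _ hmid hseg
  · exact .inl hmid
  · exact .inr ⟨hseg, by simpa only [decide_eq_true_eq] using h⟩

theorem mem_uIcc_of_abs_sub_eq {q q' m : ℤ} (h : |q - m| = |q' - m|) (hne : q' ≠ q) :
    m ∈ Set.uIcc q q' := by
  rw [abs_eq_abs] at h
  rw [Set.mem_uIcc]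
  omega

theorem eq_of_roleFromColumn (h : roleFromColumn Xb x f = true)
    (h' : roleFromColumn Xb x' f = true) (hx' : x' ∈ segment (target Xb) x)
    (hw : w ∈ f.walls) (hw' : w' ∈ f.walls)
    (hxw' : x' + dir w' ∈ segment (target Xb) (x + dir w)) : x' = x := by
  have facing_eq : facingRows Xb x' f = facingRows Xb x f := by
    rw [facingRows_eq hw (mem_of_mem_segment hxw'), facingRows_eq hw' (segment_subset hxw'),
      segmentRows_eq hxw']
  have mem : x.2 ∈ segmentRows Xb x := (self_mem_segment.2 (mem_of_mem_segment hx')).2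
  have mem' : x'.2 ∈ segmentRows Xb x := hx'.2
  have nearest := roleFromColumn_eq_true h
  have nearest' := roleFromColumn_eq_true h'
  rw [facing_eq, segmentRows_eq hx'] at nearest'
  generalize midRow (facingRows Xb x f) = m at nearest nearest'
  refine Prod.ext hx'.1 ?_
  rcases nearest with h | ⟨hm, hR, hmin⟩ <;> rcases nearest' with h' | ⟨hm', hR', hmin'⟩
  · exact h'.trans h.symm
  · exact absurd (h ▸ mem) hm'
  · exact absurd (h' ▸ mem') hm
  · by_contra hne
    have hmid := mem_uIcc_of_abs_sub_eq ((hmin _ hR').antisymm (hmin' _ hR)) hne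
    exact hm fun k hk => mem' k (Set.uIcc_subset_uIcc_left hmid hk)

theorem IsNucleationSite.eq (h : IsNucleationSite Xb x f) (h' : IsNucleationSite Xb x' f)
    (hx' : x' ∈ segment (target Xb) x) (hw : w ∈ f.walls) (hw' : w' ∈ f.walls)
    (hxw' : x' + dir w' ∈ segment (target Xb) (x + dir w)) : x' = x := by
  rcases h with ⟨v, hv, h₀, h₁, h₂⟩ | h
  · exact eq_of_isolated_contact hv h₀ h₁ h₂ hx' hw hw' hxw'
  rcases h' with ⟨v, hv, h₀, h₁, h₂⟩ | h'
  · exact (eq_of_isolated_contact hv h₀ h₁ h₂ (mem_segment_comm.1 hx') hw' hw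
      (mem_segment_comm.1 hxw')).symm
  · exact eq_of_roleFromColumn h h' hx' hw hw' hxw'

end Nucleation

/-! ### Signals and docking -/

section Signals

variable {Xb X V : Set Hex} {x b : Hex} {w v : Wall} {f : Flank} {s : Wall → Status} {m : Memory}

/-- The nucleation flag of flank `f` in a memory, as a function of the flank. -/
def Memory.nuc (m : Memory) : Flank → Bool
  | .left => m.nucLeft
  | .right => m.nucRight

theorem initMemory_nuc (Xb V : Set Hex) (b : Hex) (f : Flank) :
    (initMemory Xb V b).nuc f = nucleates Xb V b f := by
  cases f <;> rfl

theorem initMemory_growth (hnuc : nucleates Xb V b f = false)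
    (hocc : ∃ w ∈ f.walls, status Xb V b w = .occupied)
    (hopp : ∀ w ∈ f.opposite.walls, status Xb V b w ≠ .occupied) :
    (initMemory Xb V b).growth = -f.column := by
  cases f
  · have hside : status Xb V b 1 = .occupied ∨ status Xb V b 2 = .occupied := by
      simpa [Flank.walls] using hocc
    simp [initMemory, growthDirection, hnuc, hside, Flank.column]
  · have hside : status Xb V b 4 = .occupied ∨ status Xb V b 5 = .occupied := by
      simpa [Flank.walls] using hocc
    have h₁ := hopp 1 (.inl rfl)
    have h₂ := hopp 2 (.inr rfl)
    simp [initMemory, growthDirection, hnuc, hside, h₁, h₂, Flank.column]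

theorem eq_free_of_mem_nominalWalls (h : w ∈ nominalWalls s m) : s w = .free := by
  rw [nominalWalls] at h
  split_ifs at h
  · exact h.2
  · rcases h with (h | h) | h
    exacts [h.2.1, h.2.2, h.2.2]

theorem mem_foreAft_or_of_mem_nominalWalls (h : w ∈ nominalWalls s m) :
    w ∈ foreAft ∨ (∀ v ∈ foreAft, s v ≠ .free) ∧
      ∃ f : Flank, w ∈ f.walls ∧ ((∃ w' ∈ f.walls, s w' = .occupied) ∨ m.nuc f = true) := by
  rw [nominalWalls] at h
  split_ifs at h with hfree
  · exact .inl h.1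
  refine .inr ⟨fun v hv hsv => hfree ?_, ?_⟩
  · rcases hv with rfl | rfl
    exacts [.inl hsv, .inr hsv]
  rcases h with (⟨hw, -, h⟩ | ⟨hnuc, hw, -⟩) | ⟨hnuc, hw, -⟩
  · obtain ⟨f, hf⟩ := exists_mem_walls_of_notMem_foreAft hw
    refine ⟨f, hf, .inl ?_⟩
    cases f <;> rcases hf with rfl | rfl <;> simp [Flank.walls, foreAft] at h ⊢ <;> tauto
  · exact ⟨.left, hw, .inr hnuc⟩
  · exact ⟨.right, hw, .inr hnuc⟩

theorem mem_delayedWalls {n : Wall → Wall → Status} {g : ℤ} (hv : v ∈ foreAft)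
    (hg : g = -f.column) (hs : s (f.side v) = .occupied) (hn : n (f.side v) v = .free) :
    v ∈ delayedWalls s n g := by
  cases f <;> rcases hv with rfl | rfl
  · exact .inr ⟨hg, .inl ⟨rfl, hs, hn⟩⟩
  · exact .inr ⟨hg, .inr ⟨rfl, hs, hn⟩⟩
  · exact .inl ⟨hg, .inl ⟨rfl, hs, hn⟩⟩
  · exact .inl ⟨hg, .inr ⟨rfl, hs, hn⟩⟩

theorem add_dir_mem_of_mem_signals (h : w ∈ signals Xb X x m) :
    x + dir w ∈ target Xb ∧ x + dir w ∉ X :=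
  status_eq_free.1 (eq_free_of_mem_nominalWalls h.1)

theorem add_side_add_dir_mem_of_mem_signals (h : v ∈ signals Xb X x m) (hv : v ∈ foreAft)
    (hg : m.growth = -f.column) (hs : x + dir (f.side v) ∈ target Xb)
    (hX : x + dir (f.side v) ∈ X) (hsv : x + dir (f.side v) + dir v ∈ target Xb) :
    x + dir (f.side v) + dir v ∈ X := by
  by_contra hn
  exact h.2 (mem_delayedWalls hv hg (status_eq_occupied.2 ⟨hs, hX⟩) (status_eq_free.2 ⟨hsv, hn⟩))

theorem mem_foreAft_or_of_mem_signals (h : w ∈ signals Xb X x m) :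
    w ∈ foreAft ∨ (∀ v ∈ foreAft, x + dir v ∈ target Xb → x + dir v ∈ X) ∧
      ∃ f : Flank, w ∈ f.walls ∧
        ((∃ w' ∈ f.walls, x + dir w' ∈ target Xb ∧ x + dir w' ∈ X) ∨ m.nuc f = true) := by
  simpa only [status_eq_occupied, status_eq_free, not_and_not_right, ne_eq] using
    mem_foreAft_or_of_mem_nominalWalls h.1

end Signals

/-! ### The invariant of executions -/

/-- `X` meets each segment of `S` in a contiguous set of cells. -/
def IsContiguous (S X : Set Hex) : Prop :=
  ∀ x ∈ X, ∀ y ∈ X, y ∈ segment S x → y ∈ segment X x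

/-- The invariant of executions. Besides contiguity of the occupied part of each segment, it says
that a robot has no free wall towards the parent segment and grows away from it (`parent`), and that
a nonempty segment is occupied next to the nucleation site in its parent (`nucleated`). -/
structure Invariant (Xb : Set Hex) (σ : State) : Prop where
  root : (0, 0) ∈ occupied σ
  subset : occupied σ ⊆ target Xb
  reachable : ∀ x ∈ occupied σ, (assemblyGraph (occupied σ)).Reachable (0, 0) x
  contiguous : IsContiguous (target Xb) (occupied σ)
  parent : ∀ x m, σ x = some m → ∀ (f : Flank), ∀ w ∈ f.walls, x + dir w ∈ target Xb →
    Precedes (target Xb) (0, 0) (x + dir w) x →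
      x + dir w ∈ occupied σ ∧ m.nuc f = false ∧ m.growth = -f.column
  site : ∀ x m, σ x = some m → ∀ f, m.nuc f = true → IsNucleationSite Xb x f
  nucleated : ∀ x ∈ target Xb, ∀ (f : Flank), ∀ w ∈ f.walls, x + dir w ∈ target Xb →
    IsNucleationSite Xb x f → Precedes (target Xb) (0, 0) x (x + dir w) →
      (∃ c ∈ occupied σ, c ∈ segment (target Xb) (x + dir w)) →
        ∃ w' ∈ f.walls, x + dir w' ∈ occupied σ

/-- Some robot of the assembly signals towards the cell `b`. -/
def IsSignalled (Xb : Set Hex) (σ : State) (b : Hex) : Prop :=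
  ∃ x m w, σ x = some m ∧ w ∈ signals Xb (occupied σ) x m ∧ b = x + dir w

theorem IsSignalled.mem {Xb : Set Hex} {σ : State} {b : Hex} (hb : IsSignalled Xb σ b) :
    b ∈ target Xb ∧ b ∉ occupied σ := by
  obtain ⟨x, m, w, -, hw, rfl⟩ := hb
  exact add_dir_mem_of_mem_signals hw

theorem IsInitial.occupied_eq {Xb : Set Hex} {σ : State} (h : IsInitial Xb σ) :
    occupied σ = {(0, 0)} := by
  ext x
  refine ⟨fun ⟨m, hm⟩ => ?_, fun hx => ⟨_, hx ▸ h.1⟩⟩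
  by_contra hx
  simp [h.2 x hx] at hm

namespace Invariant

variable {Xb Y : Set Hex} {σ : State} {b x : Hex} {f : Flank} {u v w : Wall} {m : Memory}

theorem of_isInitial (hroot : (0, 0) ∈ target Xb) (h : IsInitial Xb σ) : Invariant Xb σ := by
  have hocc := h.occupied_eq
  have eq_root {x m} (hm : σ x = some m) : x = (0, 0) :=
    Set.mem_singleton_iff.1 (hocc ▸ (⟨m, hm⟩ : x ∈ occupied σ))
  refine ⟨⟨_, h.1⟩, ?_, ?_, ?_, ?_, ?_, ?_⟩
  · simpa only [hocc, Set.singleton_subset_iff] using hroot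
  · rintro x ⟨m, hm⟩
    rw [eq_root hm]
  · rintro x ⟨m, hm⟩ y ⟨m', hm'⟩ -
    rw [eq_root hm, eq_root hm', self_mem_segment]
    exact ⟨_, h.1⟩
  · intro x m hm f w _ _ hp
    exact absurd (self_mem_segment.2 hroot) (eq_root hm ▸ hp.1)
  · intro x m hm f hf
    obtain rfl := eq_root hm
    obtain rfl := Option.some.inj (h.1.symm.trans hm)
    rw [initMemory_nuc] at hf
    exact isNucleationSite_of_nucleates hf
  · rintro x _ f w _ _ _ hp ⟨c, ⟨m, hm⟩, hc⟩
    exact absurd (eq_root hm ▸ hc) hp.1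

theorem precedes_of_free (hI : Invariant Xb σ) (hx : x ∈ occupied σ) (hw : w ∈ f.walls)
    (hs : x + dir w ∈ target Xb) (hn : x + dir w ∉ occupied σ) :
    Precedes (target Xb) (0, 0) x (x + dir w) := by
  have hr := (hI.reachable x hx).mono (assemblyGraph_mono hI.subset)
  obtain ⟨m, hm⟩ := hx
  refine (precedes_or_precedes (adj_add_dir (hI.subset ⟨m, hm⟩) hs) (fst_add_dir_ne hw).symm
    hr).resolve_right fun hp => ?_
  exact hn (hI.parent x m hm f w hw hs hp).1

theorem reachable_of_isSignalled (hI : Invariant Xb σ) (hb : IsSignalled Xb σ b)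
    (hY : occupied σ ⊆ Y) (hbY : b ∈ Y) : (assemblyGraph Y).Reachable (0, 0) b := by
  obtain ⟨x, m, w, hx, -, rfl⟩ := hb
  have hxX : x ∈ occupied σ := ⟨m, hx⟩
  exact ((hI.reachable x hxX).mono (assemblyGraph_mono hY)).trans
    (adj_add_dir (hY hxX) hbY).reachable

theorem add_side_mem (hfin : (target Xb).Finite) (hS : HoleFreeShape (target Xb))
    (hI : Invariant Xb σ) (hx : x ∈ occupied σ) (hv : v ∈ foreAft) (hb : x + dir v ∈ target Xb)
    (hbX : x + dir v ∉ occupied σ) (hs : x + dir v + dir (f.side v) ∈ target Xb)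
    (hp : Precedes (target Xb) (0, 0) (x + dir v + dir (f.side v)) (x + dir v)) :
    x + dir (f.side v) ∈ target Xb := by
  by_contra hn
  have hxb := add_dir_mem_segment hv (hI.subset hx) hb
  have hpx := hp.congr_right (mem_segment_comm.1 hxb)
  obtain ⟨a, c, hc, hcx, hca, hac, hpa⟩ :=
    exists_precedes hI.subset (hI.reachable x hx) (hI.subset hx) hpx.1
  have hcb := mem_segment_trans (mem_segment_comm.1 hxb) hcx
  have ha := hp.mem_segment hfin hS hpa hcb (adj_add_dir hb hs) hca
    (fst_add_dir_ne (side_mem_walls f v))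
  obtain ⟨w, hw, rfl⟩ : ∃ w ∈ f.walls, a = c + dir w := by
    obtain ⟨-, -, w, rfl⟩ := hca
    refine ⟨w, mem_walls_of_fst_add_dir (x := c) ?_, rfl⟩
    rw [ha.1, fst_add_dir (side_mem_walls f v), hcb.1]
  have hbetween := snd_mem_uIcc_of_add_dir_notMem (x := x + dir v) hv
    (by rwa [add_right_comm _ (dir (f.side v)), add_dir_add_dir_add_three]) hw ha
  rw [add_dir_add_dir_add_three] at hbetween
  have hbX' := (hI.contiguous x hx c hc hcx).2 hbetween
  exact hbX (by rwa [Set.mem_preimage, ← hxb.1] at hbX')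

theorem add_dir_side_mem_of_mem_signals (hfin : (target Xb).Finite)
    (hS : HoleFreeShape (target Xb)) (hI : Invariant Xb σ) (hx : σ x = some m) (hv : v ∈ foreAft)
    (hsig : v ∈ signals Xb (occupied σ) x m) (hs : x + dir v + dir (f.side v) ∈ target Xb)
    (hp : Precedes (target Xb) (0, 0) (x + dir v + dir (f.side v)) (x + dir v)) :
    x + dir v + dir (f.side v) ∈ occupied σ := by
  have hxX : x ∈ occupied σ := ⟨m, hx⟩
  obtain ⟨hb, hbX⟩ := add_dir_mem_of_mem_signals hsig
  have ha := add_side_mem hfin hS hI hxX hv hb hbX hs hp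
  have hxb := add_dir_mem_segment hv (hI.subset hxX) hb
  have hfst := fst_add_dir_ne (x := x + dir v) (side_mem_walls f v)
  rw [hxb.1] at hfst
  rw [add_right_comm] at hs hp hfst ⊢
  have hpx := (hp.congr_right (mem_segment_comm.1 hxb)).congr_left
    (mem_segment_comm.1 (add_dir_mem_segment hv ha hs)) hfst
  obtain ⟨haX, -, hg⟩ := hI.parent x m hx f _ (side_mem_walls f v) ha hpx
  exact add_side_add_dir_mem_of_mem_signals hsig hv hg ha haX hs

theorem add_dir_mem_of_foreAft_occupied (hfin : (target Xb).Finite)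
    (hS : HoleFreeShape (target Xb)) (hI : Invariant Xb σ) (hx : x ∈ occupied σ)
    (hfa : ∀ v ∈ foreAft, x + dir v ∈ target Xb → x + dir v ∈ occupied σ) {f' : Flank}
    (hw : w ∈ f'.walls) (hb : x + dir w ∈ target Xb) (hbX : x + dir w ∉ occupied σ)
    (hu : u ∈ f.walls) (hs : x + dir w + dir u ∈ target Xb)
    (hp : Precedes (target Xb) (0, 0) (x + dir w + dir u) (x + dir w)) :
    x + dir w + dir u ∈ occupied σ := by
  have hpx := hI.precedes_of_free hx hw hb hbX
  have hxu := hpx.mem_segment hfin hS hp (self_mem_segment.2 hb)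
    (adj_add_dir (hI.subset hx) hb).symm (adj_add_dir hb hs) (fst_add_dir_ne hw).symm
  have hback : w + 3 ∈ f.walls := mem_walls_of_fst_add_dir (x := x + dir w) <| by
    rw [add_dir_add_dir_add_three, ← fst_add_dir hu, hxu.1]
  rcases add_dir_eq_or hback hu (x + dir w) with h | ⟨v, hv, h⟩
  · rwa [h, add_dir_add_dir_add_three]
  · rw [h, add_dir_add_dir_add_three] at hs ⊢
    exact hfa v hv hs

theorem parent_mem_of_isSignalled (hfin : (target Xb).Finite) (hS : HoleFreeShape (target Xb))
    (hI : Invariant Xb σ) (hb : IsSignalled Xb σ b) (hu : u ∈ f.walls)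
    (hs : b + dir u ∈ target Xb) (hp : Precedes (target Xb) (0, 0) (b + dir u) b) :
    b + dir u ∈ occupied σ := by
  obtain ⟨x, m, w, hx, hsig, rfl⟩ := hb
  have hxX : x ∈ occupied σ := ⟨m, hx⟩
  obtain ⟨hb, hbX⟩ := add_dir_mem_of_mem_signals hsig
  rcases mem_foreAft_or_of_mem_signals hsig with hv | ⟨hfa, f', hw, -⟩
  · rcases eq_side_or_eq_side hu hv with rfl | rfl
    · exact hI.add_dir_side_mem_of_mem_signals hfin hS hx hv hsig hs hp
    · have hxb := add_dir_mem_segment hv (hI.subset hxX) hb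
      rw [add_assoc, ← dir_side f hv] at hs hp ⊢
      exact (hI.parent x m hx f _ (side_mem_walls f w) hs
        (hp.congr_right (mem_segment_comm.1 hxb))).1
  · exact hI.add_dir_mem_of_foreAft_occupied hfin hS hxX hfa hw hb hbX hu hs hp

theorem exists_mem_segment_of_isSignalled (hI : Invariant Xb σ) (hb : IsSignalled Xb σ b)
    (hc : ∃ c ∈ occupied σ, c ∈ segment (target Xb) b) (hY : occupied σ ⊆ Y) (hbY : b ∈ Y) :
    ∃ c ∈ occupied σ, c ∈ segment Y b := by
  obtain ⟨x, m, w, hx, hsig, rfl⟩ := hb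
  have hxX : x ∈ occupied σ := ⟨m, hx⟩
  obtain ⟨hb, hbX⟩ := add_dir_mem_of_mem_signals hsig
  rcases mem_foreAft_or_of_mem_signals hsig with hv | ⟨-, f, hw, hflank⟩
  · exact ⟨x, hxX, mem_segment_comm.1 (add_dir_mem_segment hv (hY hxX) hbY)⟩
  obtain ⟨w', hw', hX⟩ : ∃ w' ∈ f.walls, x + dir w' ∈ occupied σ := by
    rcases hflank with ⟨w', hw', -, hX⟩ | hnuc
    · exact ⟨w', hw', hX⟩
    · exact hI.nucleated x (hI.subset hxX) f w hw hb (hI.site x m hx f hnuc)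
        (hI.precedes_of_free hxX hw hb hbX) hc
  exact ⟨_, hX, add_dir_mem_segment_add_dir hw hw' hbY (hY hX)⟩

theorem exists_isNucleationSite (hI : Invariant Xb σ) (hb : IsSignalled Xb σ b)
    (hempty : ∀ c ∈ occupied σ, c ∉ segment (target Xb) b) :
    ∃ x ∈ occupied σ, ∃ (f : Flank), ∃ w ∈ f.walls, IsNucleationSite Xb x f ∧
      Precedes (target Xb) (0, 0) x b ∧ b = x + dir w := by
  obtain ⟨x, m, w, hx, hsig, rfl⟩ := hb
  have hxX : x ∈ occupied σ := ⟨m, hx⟩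
  have hb := (add_dir_mem_of_mem_signals hsig).1
  rcases mem_foreAft_or_of_mem_signals hsig with hv | ⟨-, f, hw, ⟨w', hw', hs, hX⟩ | hnuc⟩
  · exact absurd (mem_segment_comm.1 (add_dir_mem_segment hv (hI.subset hxX) hb)) (hempty x hxX)
  · exact absurd (add_dir_mem_segment_add_dir hw hw' hb hs) (hempty _ hX)
  · exact ⟨x, hxX, f, w, hw, hI.site x m hx f hnuc,
      precedes_of_disjoint hI.subset hI.root (hI.reachable x hxX) hempty, rfl⟩

theorem eq_add_dir_of_isSignalled (hfin : (target Xb).Finite) (hS : HoleFreeShape (target Xb))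
    (hI : Invariant Xb σ) (hx : x ∈ target Xb) (hw : w ∈ f.walls) (hs : x + dir w ∈ target Xb)
    (hsite : IsNucleationSite Xb x f) (hp : Precedes (target Xb) (0, 0) x (x + dir w))
    (hb : IsSignalled Xb σ b) (hbw : b ∈ segment (target Xb) (x + dir w))
    (hempty : ∀ c ∈ occupied σ, c ∉ segment (target Xb) b) : ∃ w' ∈ f.walls, b = x + dir w' := by
  obtain ⟨x', hx', f', w', hw', hsite', hp', rfl⟩ := hI.exists_isNucleationSite hb hempty
  have hxx' := hp.mem_segment hfin hS hp' hbw (adj_add_dir hx hs).symm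
    (adj_add_dir (hI.subset hx') hb.mem.1).symm (fst_add_dir_ne hw).symm
  obtain rfl : f' = f := by
    have hfst := hbw.1
    rw [fst_add_dir hw', fst_add_dir hw, hxx'.1, add_right_inj] at hfst
    exact Flank.column_injective hfst
  exact ⟨w', hw', by rw [hsite.eq hsite' hxx' hw hw' hbw]⟩

end Invariant

/-! ### Steps preserve the invariant -/

section Step

variable {Xb V : Set Hex} {σ τ : State} {b c x : Hex} {f : Flank} {u v w : Wall} {m : Memory}

theorem Step.occupied_subset (h : Step Xb σ τ) : occupied σ ⊆ occupied τ :=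
  fun x ⟨m, hm⟩ => ⟨m, h.1 x m hm⟩

theorem Step.eq_some_or_docks (h : Step Xb σ τ) (hm : τ b = some m) :
    σ b = some m ∨ IsSignalled Xb σ b ∧
      ∃ V, occupied σ ⊆ V ∧ V ⊆ occupied τ ∧ m = initMemory Xb V b := by
  cases hσ : σ b with
  | some m' => exact .inl ((h.1 b m' hσ).symm.trans hm)
  | none => exact .inr (h.2 b m hσ hm)

theorem Step.mem_or_isSignalled (h : Step Xb σ τ) (hb : b ∈ occupied τ) :
    b ∈ occupied σ ∨ IsSignalled Xb σ b := by
  obtain ⟨m, hm⟩ := hb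
  exact (h.eq_some_or_docks hm).imp (fun hσ => ⟨m, hσ⟩) And.left

theorem Invariant.occupied_subset_of_step (hI : Invariant Xb σ) (h : Step Xb σ τ) :
    occupied τ ⊆ target Xb :=
  fun _ hb => (h.mem_or_isSignalled hb).elim (fun hb => hI.subset hb) fun hb => hb.mem.1

theorem Invariant.parent_mem_of_step (hfin : (target Xb).Finite) (hS : HoleFreeShape (target Xb))
    (hI : Invariant Xb σ) (h : Step Xb σ τ) (hb : b ∈ occupied τ) (hw : w ∈ f.walls)
    (hs : b + dir w ∈ target Xb) (hp : Precedes (target Xb) (0, 0) (b + dir w) b) :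
    b + dir w ∈ occupied σ := by
  rcases h.mem_or_isSignalled hb with ⟨m, hm⟩ | hsig
  · exact (hI.parent b m hm f w hw hs hp).1
  · exact hI.parent_mem_of_isSignalled hfin hS hsig hw hs hp

theorem Invariant.opposite_notMem_of_step (hfin : (target Xb).Finite)
    (hS : HoleFreeShape (target Xb)) (hI : Invariant Xb σ) (h : Step Xb σ τ)
    (hb : IsSignalled Xb σ b) (hu : u ∈ f.walls) (hs : b + dir u ∈ target Xb)
    (hp : Precedes (target Xb) (0, 0) (b + dir u) b) (hw : w ∈ f.opposite.walls) :
    b + dir w ∉ occupied τ := by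
  intro hτ
  obtain ⟨hbT, hbX⟩ := hb.mem
  have hwT := hI.occupied_subset_of_step h hτ
  rcases precedes_or_precedes (adj_add_dir hbT hwT) (fst_add_dir_ne hw).symm
    (hI.reachable_of_isSignalled hb hI.subset hbT) with hbw | hwb
  · have hback := add_dir_add_dir_add_three b w
    have hb' := hI.parent_mem_of_step hfin hS h hτ (add_three_mem_walls_opposite hw)
      (by rwa [hback]) (by rwa [hback])
    exact hbX (by rwa [hback] at hb')
  · have hfst := (hp.mem_segment hfin hS hwb (self_mem_segment.2 hbT) (adj_add_dir hbT hs)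
      (adj_add_dir hbT hwT) (fst_add_dir_ne hu)).1
    rw [fst_add_dir hw, fst_add_dir hu, f.column_opposite] at hfst
    have := f.column_eq_or
    omega

theorem Invariant.nucleates_eq_false (hfin : (target Xb).Finite) (hS : HoleFreeShape (target Xb))
    (hI : Invariant Xb σ) (hb : IsSignalled Xb σ b) (hV : occupied σ ⊆ V) (hu : u ∈ f.walls)
    (hs : b + dir u ∈ target Xb) (hp : Precedes (target Xb) (0, 0) (b + dir u) b) :
    nucleates Xb V b f = false :=
  Huddle.nucleates_eq_false fun _ hw hwT => hV <|
    hI.parent_mem_of_isSignalled hfin hS hb hw hwT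
      (hp.congr_left (add_dir_mem_segment_add_dir hu hw hs hwT) (fst_add_dir_ne hu))

theorem Invariant.growth_of_step (hfin : (target Xb).Finite) (hS : HoleFreeShape (target Xb))
    (hI : Invariant Xb σ) (h : Step Xb σ τ) (hb : IsSignalled Xb σ b) (hV : occupied σ ⊆ V)
    (hV' : V ⊆ occupied τ) (hu : u ∈ f.walls) (hs : b + dir u ∈ target Xb)
    (hp : Precedes (target Xb) (0, 0) (b + dir u) b) :
    (initMemory Xb V b).growth = -f.column := by
  have huX := hI.parent_mem_of_isSignalled hfin hS hb hu hs hp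
  refine initMemory_growth (hI.nucleates_eq_false hfin hS hb hV hu hs hp)
    ⟨u, hu, status_eq_occupied.2 ⟨hs, hV huX⟩⟩ fun w hw hocc => ?_
  exact hI.opposite_notMem_of_step hfin hS h hb hu hs hp hw (hV' (status_eq_occupied.1 hocc).2)

theorem Invariant.isContiguous_of_step (hfin : (target Xb).Finite) (hS : HoleFreeShape (target Xb))
    (hI : Invariant Xb σ) (h : Step Xb σ τ) : IsContiguous (target Xb) (occupied τ) := by
  intro x hx y hy hxy
  have hsub := hI.occupied_subset_of_step h
  by_cases hempty : ∀ c ∈ occupied σ, c ∉ segment (target Xb) x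
  · have hx' := (h.mem_or_isSignalled hx).resolve_left
      fun hx' => hempty x hx' (self_mem_segment.2 (hsub hx))
    have hy' := (h.mem_or_isSignalled hy).resolve_left fun hy' => hempty y hy' hxy
    obtain ⟨a, ha, f, w, hw, hsite, hp, rfl⟩ := hI.exists_isNucleationSite hx' hempty
    obtain ⟨w', hw', rfl⟩ := hI.eq_add_dir_of_isSignalled hfin hS (hI.subset ha) hw (hsub hx)
      hsite hp hy' hxy (by rwa [segment_eq hxy])
    exact add_dir_mem_segment_add_dir hw hw' hx hy
  · push Not at hempty
    obtain ⟨c, hc, hcx⟩ := hempty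
    have exists_old {z : Hex} (hz : z ∈ occupied τ) (hzx : z ∈ segment (target Xb) x) :
        ∃ z' ∈ occupied σ, z' ∈ segment (occupied τ) z := by
      rcases h.mem_or_isSignalled hz with hz' | hz'
      · exact ⟨z, hz', self_mem_segment.2 hz⟩
      · exact hI.exists_mem_segment_of_isSignalled hz' ⟨c, hc, by rwa [segment_eq hzx]⟩
          h.occupied_subset hz
    obtain ⟨x', hx', hxx'⟩ := exists_old hx (self_mem_segment.2 (hsub hx))
    obtain ⟨y', hy', hyy'⟩ := exists_old hy hxy
    have hxy' : y' ∈ segment (target Xb) x' := by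
      rw [segment_eq (segment_mono hsub hxx')]
      exact mem_segment_trans hxy (segment_mono hsub hyy')
    have hold := segment_mono h.occupied_subset (hI.contiguous x' hx' y' hy' hxy')
    exact mem_segment_trans (mem_segment_trans hxx' hold) (mem_segment_comm.1 hyy')

theorem Invariant.nucleated_of_step (hfin : (target Xb).Finite) (hS : HoleFreeShape (target Xb))
    (hI : Invariant Xb σ) (h : Step Xb σ τ) (hx : x ∈ target Xb) (hw : w ∈ f.walls)
    (hs : x + dir w ∈ target Xb) (hsite : IsNucleationSite Xb x f)
    (hp : Precedes (target Xb) (0, 0) x (x + dir w)) (hc : c ∈ occupied τ)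
    (hcw : c ∈ segment (target Xb) (x + dir w)) : ∃ w' ∈ f.walls, x + dir w' ∈ occupied τ := by
  by_cases hempty : ∀ c ∈ occupied σ, c ∉ segment (target Xb) (x + dir w)
  · have hc' := (h.mem_or_isSignalled hc).resolve_left fun hc' => hempty c hc' hcw
    obtain ⟨w', hw', rfl⟩ := hI.eq_add_dir_of_isSignalled hfin hS hx hw hs hsite hp hc' hcw
      (by rwa [segment_eq hcw])
    exact ⟨w', hw', hc⟩
  · push Not at hempty
    obtain ⟨w', hw', hX⟩ := hI.nucleated x hx f w hw hs hsite hp hempty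
    exact ⟨w', hw', h.occupied_subset hX⟩

theorem Invariant.step (hfin : (target Xb).Finite) (hS : HoleFreeShape (target Xb))
    (hI : Invariant Xb σ) (h : Step Xb σ τ) : Invariant Xb τ where
  root := h.occupied_subset hI.root
  subset := hI.occupied_subset_of_step h
  reachable x hx := (h.mem_or_isSignalled hx).elim
    (fun hx' => (hI.reachable x hx').mono (assemblyGraph_mono h.occupied_subset))
    (fun hx' => hI.reachable_of_isSignalled hx' h.occupied_subset hx)
  contiguous := hI.isContiguous_of_step hfin hS h
  parent x m hm f w hw hs hp := by
    rcases h.eq_some_or_docks hm with hσ | ⟨hsig, V, hV, hV', rfl⟩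
    · exact (hI.parent x m hσ f w hw hs hp).imp_left (h.occupied_subset ·)
    · refine ⟨h.occupied_subset (hI.parent_mem_of_isSignalled hfin hS hsig hw hs hp), ?_,
        hI.growth_of_step hfin hS h hsig hV hV' hw hs hp⟩
      rw [initMemory_nuc]
      exact hI.nucleates_eq_false hfin hS hsig hV hw hs hp
  site x m hm f hf := by
    rcases h.eq_some_or_docks hm with hσ | ⟨-, V, -, -, rfl⟩
    · exact hI.site x m hσ f hf
    · rw [initMemory_nuc] at hf
      exact isNucleationSite_of_nucleates hf
  nucleated x hx f w hw hs hsite hp hc := by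
    obtain ⟨c, hc, hcw⟩ := hc
    exact hI.nucleated_of_step hfin hS h hx hw hs hsite hp hc hcw

theorem Invariant.of_isExecution {σ : ℕ → State} (hfin : (target Xb).Finite)
    (hroot : (0, 0) ∈ target Xb) (hS : HoleFreeShape (target Xb)) (hσ : IsExecution Xb σ) (t : ℕ) :
    Invariant Xb (σ t) := by
  induction t with
  | zero => exact .of_isInitial hroot hσ.1
  | succ t ih => exact ih.step hfin hS (hσ.2 t)

end Step

/-! ### Contiguous subsets of a hole-free shape -/

section Contiguous

variable {S X : Set Hex} {y : Hex}

theorem IsContiguous.lt_of_lt {a b : Hex} (hc : IsContiguous S X) (hyX : y ∉ X)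
    (ha : a ∈ X) (hay : a ∈ segment S y) (hlt : y.2 < a.2) (hb : b ∈ X)
    (hby : b ∈ segment S y) : y.2 < b.2 := by
  by_contra hle
  have hba : a ∈ segment X b := hc b hb a ha (by rwa [segment_eq hby])
  have hyX' := hba.2 (Set.mem_uIcc_of_le (not_lt.1 hle) hlt.le)
  exact hyX (by rwa [Set.mem_preimage, hby.1] at hyX')

theorem exists_notMem_forall_lt_iff (hfin : S.Finite) (hX : X ⊆ S) (hc : IsContiguous S X)
    (hy : y ∈ S) (hyX : y ∉ X) :
    ∃ z ∉ S, z.1 = y.1 ∧ ∀ a ∈ X, a.1 = y.1 → (y.2 < a.2 ↔ z.2 < a.2) := by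
  obtain ⟨l, u, hl, hu, hseg⟩ := exists_segment_bounds hfin hy
  obtain ⟨-, hly, hyu⟩ := (hseg y).1 (self_mem_segment.2 hy)
  have outside {a : Hex} (ha : a ∈ X) (hfst : a.1 = y.1) (hay : a ∉ segment S y) :
      a.2 < l ∨ u < a.2 :=
    lt_or_lt_of_notMem_segment hl hu hseg (hX ha) hay hfst
  by_cases habove : ∃ a ∈ X, a ∈ segment S y ∧ y.2 < a.2
  · obtain ⟨a, ha, hay, hlt⟩ := habove
    refine ⟨(y.1, l), hl, rfl, fun b hb hfst => ?_⟩
    by_cases hby : b ∈ segment S y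
    · exact iff_of_true (hc.lt_of_lt hyX ha hay hlt hb hby) ((hseg b).1 hby).2.1
    · have := outside hb hfst hby
      dsimp only
      omega
  · refine ⟨(y.1, u), hu, rfl, fun b hb hfst => ?_⟩
    by_cases hby : b ∈ segment S y
    · exact iff_of_false (fun hlt => habove ⟨b, hb, hby, hlt⟩) ((hseg b).1 hby).2.2.not_gt
    · have := outside hb hfst hby
      dsimp only
      omega

theorem IsContiguous.holeFreeAssembly (hfin : S.Finite) (hS : HoleFreeShape S) (hX : X ⊆ S)
    (hc : IsContiguous S X) : HoleFreeAssembly S X := by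
  rintro v c - y ⟨hyS, hyX⟩ henc
  obtain ⟨z, hz, hzy, hlt⟩ := exists_notMem_forall_lt_iff hfin hX hc hyS hyX
  have hpot : HasPotential (assemblyGraph X) (crossing .right y) :=
    ((hS.hasPotential_crossing hz .right).mono (assemblyGraph_mono hX)).congr fun a b hab =>
      crossing_congr hzy (hlt a hab.1) (hlt b hab.2.1)
  exact zero_ne_one ((hpot.walkSum_eq_zero c).symm.trans (encloses_iff.1 henc).2)

end Contiguous

end Huddle

theorem theorem2_general {S Xb : Set Huddle.Hex} (hXb : Huddle.target Xb = S) (hfin : S.Finite)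
    (hroot : (0, 0) ∈ S) (hS : Huddle.HoleFreeShape S) {σ : ℕ → Huddle.State}
    (hσ : Huddle.IsExecution Xb σ) (t : ℕ) :
    Huddle.HoleFreeAssembly S (Huddle.occupied (σ t)) := by
  subst hXb
  have hinv := Huddle.Invariant.of_isExecution hfin hroot hS hσ t
  exact hinv.contiguous.holeFreeAssembly hfin hS hinv.subset

theorem theorem2 (S : Set Huddle.Hex) (hfin : S.Finite) (hroot : (0, 0) ∈ S)
    (hS : Huddle.HoleFreeShape S)
    (σ : ℕ → Huddle.State) (hσ : Huddle.IsExecution (Huddle.perimeter S) σ) (t : ℕ) :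
    Huddle.HoleFreeAssembly S (Huddle.occupied (σ t)) :=
  theorem2_general (Huddle.target_perimeter hfin hS) hfin hroot hS hσ t
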